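/- Let $\mathfrak g$ be a finite-dimensional complex simple Lie algebra of type $A_n$ ($n\ge 1$) or $D_n$ ($n\ge 4$), with Cartan subalgebra $\mathfrak h$, simple roots $\alpha_1,\dots,\alpha_n$ (Bourbaki labelling), simple coroots $h_i=h_{\alpha_i}$, positive roots $R^+$ and, for $\alpha\in R^+$, coroot $h_\alpha$ and nonzero root vectors $x_\alpha^{\pm}$ of weight $\pm\alpha$; write $x_i^-=x_{\alpha_i}^-$, let $\mathfrak n^+$ be the span of the $x_\alpha^+$, and let $P^+$ be the set of dominant integral weights. Let $\mathfrak g[t]=\mathfrak g\otimes\mathbb C[t]$ be the current algebra, graded by $\deg(x\otimes t^r)=r$. For $\nu\in P^+$ call the following relations on a vector $w$ the local Weyl relations of weight $\nu$: $$\mathfrak n^+[t]\,w=0,\qquad (h\otimes t^r)w=\delta_{r,0}\,\nu(h)w\ (h\in\mathfrak h,\ r\ge 0),\qquad (x_i^-\otimes 1)^{\nu(h_i)+1}w=0\ (1\le i\le n).$$ * For $\lambda,\mu\in P^+$, $V(\lambda,\mu)$ is the graded $\mathfrak g[t]$-module generated by an element $w_{\lambda,\mu}$ of degree $0$ with defining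 relations the local Weyl relations of weight $\lambda+\mu$ and $(x_\alpha^-\otimes t^{\max\{\lambda(h_\alpha),\mu(h_\alpha)\}})w_{\lambda,\mu}=0$ for all $\alpha\in R^+$. * For $\ell\ge 1$ and $\lambda\in P^+$, the stable level $\ell$ Demazure module $D(\ell,\lambda)$ is the graded $\mathfrak g[t]$-module generated by an element $w_\lambda$ of degree $0$ with defining relations the local Weyl relations of weight $\lambda$ and, for all $\alpha\in R^+$, $(x_\alpha^-\otimes t^{s_\alpha})w_\lambda=0$ and (if $s_\alpha\ge 1$) $(x_\alpha^-\otimes t^{s_\alpha-1})^{m_\alpha+1}w_\lambda=0$, where $\lambda(h_\alpha)=\ell(s_\alpha-1)+m_\alpha$ with integers $s_\alpha\ge 0$, $0<m_\alpha\le \ell$. A pair $(\nu_1,\nu_2)\in P^+\times P^+$ is called interlacing if $(\nu_1+\nu_2)(h_i)\le 1$ for all $i$ and, for $\{r,p\}=\{1,2\}$: * whenever $i<j$ and $\nu_r(h_i)=1=\nu_r(h_j)$ (in type $D_n$ only for $(i,j)\neq(n-1,n)$), there is $s$ with $i<s<j$ and $\nu_p(h_s)=1$; * in type $D_n$, moreover,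 $\nu_r(h_{n-1}+h_n)>0$ implies $\nu_p(h_{n-1}+h_n)=0$. **Proposition.** Let $(\nu_1,\nu_2)$ be an interlacing pair. For $\alpha\in R^+$ put $v_\alpha=(x_\alpha^-\otimes t^{\lceil(\nu_1+\nu_2)(h_\alpha)/2\rceil})\,w_{\nu_1,\nu_2}\in V(\nu_1,\nu_2)$. Then either $V(\nu_1,\nu_2)\cong D(2,\nu_1+\nu_2)$ as graded $\mathfrak g[t]$-modules, via $w_{\nu_1,\nu_2}\mapsto w_{\nu_1+\nu_2}$, or there is a unique root $\beta$ of minimal height in the set $\{\alpha\in R^+: v_\alpha\ne 0\}$ (which is then non-empty) and there is a short exact sequence of graded $\mathfrak g[t]$-modules $$0\to \langle v_\beta\rangle\to V(\nu_1,\nu_2)\to D(2,\nu_1+\nu_2)\to 0,$$ in which $\langle v_\beta\rangle$ is the submodule generated by $v_\beta$, the first map is the inclusion, and the second map sends $w_{\nu_1,\nu_2}$ to $w_{\nu_1+\nu_2}$. -/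

import Mathlib

open scoped TensorProduct Polynomial
open LieAlgebra LieAlgebra.IsKilling Module

noncomputable section

namespace CurrentAlg

/-- The two simply laced classical families of simple Lie algebras. -/
inductive SLType
  | A
  | D

/-- The Cartan matrix of type `A_n` or `D_n`. The nodes `1, …, n` of the usual (Bourbaki)
labelling are `0, …, n - 1` here; in type `D_n` the two end nodes of the fork are the last two. -/
def SLType.cartanMatrix : SLType → (n : ℕ) → Matrix (Fin n) (Fin n) ℤ
  | .A, n => CartanMatrix.A n
  | .D, n => CartanMatrix.D n

/-- The least rank: `A_n` for `n ≥ 1`, `D_n` for `n ≥ 4`. -/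
def SLType.minRank : SLType → ℕ
  | .A => 1
  | .D => 4

section Current

variable (L : Type*) [LieRing L] [LieAlgebra ℂ L]

/-- The universal enveloping algebra `U(𝔤[t])` of the current algebra `𝔤[t] = ℂ[t] ⊗ 𝔤`,
viewed as a complex Lie algebra. Left `U(𝔤[t])`-modules are the same as `𝔤[t]`-modules. -/
abbrev CurrentEnv : Type _ := UniversalEnvelopingAlgebra ℂ (ℂ[X] ⊗[ℂ] L)

variable {L}

/-- The element `x ⊗ t ^ r` of `𝔤[t]`, inside `U(𝔤[t])`. -/
def cur (x : L) (r : ℕ) : CurrentEnv L :=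
  UniversalEnvelopingAlgebra.ι ℂ ((Polynomial.X ^ r : ℂ[X]) ⊗ₜ[ℂ] x)

variable (L) in
/-- The degree `k` part of `U(𝔤[t])`, for the grading in which `x ⊗ t ^ r` has degree `r`. -/
def envDegree (k : ℕ) : Submodule ℂ (CurrentEnv L) :=
  Submodule.span ℂ
    {u | ∃ l : List (L × ℕ), (l.map Prod.snd).sum = k ∧
      u = (l.map fun p => cur p.1 p.2).prod}

/-- The `𝔤[t]`-module with one generator `w` and the defining relations `u w = 0` for `u ∈ rel`. -/
abbrev CyclicModule (rel : Set (CurrentEnv L)) : Type _ :=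
  CurrentEnv L ⧸ Submodule.span (CurrentEnv L) rel

/-- The generator of a module given by generator and relations. -/
def gen (rel : Set (CurrentEnv L)) : CyclicModule rel := Submodule.Quotient.mk 1

/-- The degree `k` part of a module given by a generator and (homogeneous) relations; the
generator has degree zero. -/
def degreePart (rel : Set (CurrentEnv L)) (k : ℕ) : Submodule ℂ (CyclicModule rel) :=
  (envDegree L k).map
    ((Submodule.mkQ (Submodule.span (CurrentEnv L) rel)).restrictScalars ℂ)

/-- The map `f` preserves degrees. -/
def IsGraded {rel rel' : Set (CurrentEnv L)}
    (f : CyclicModule rel →ₗ[CurrentEnv L] CyclicModule rel') : Prop :=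
  ∀ k, ∀ v ∈ degreePart rel k, f v ∈ degreePart rel' k

end Current

section Weights

theorem isPos_flip {ι M N : Type*} [Finite ι] [AddCommGroup M] [Module ℂ M] [AddCommGroup N]
    [Module ℂ N] {P : RootPairing ι ℂ M N} [P.IsCrystallographic] [P.IsReduced] (b : P.Base)
    {i : ι} (hi : b.IsPos i) : b.flip.IsPos i := by
  refine hi.induction_on_reflect (p := fun k => b.IsPos k → b.flip.IsPos k)
    (fun j hj _ => RootPairing.Base.isPos_of_mem_support hj) ?_ hi
  intro i j hij hj hpos
  by_cases hne : P.reflectionPerm j i = j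
  · rw [hne]
    exact RootPairing.Base.isPos_of_mem_support hj
  · have hi : b.IsPos i := by
      simpa using hpos.reflectionPerm hj hne
    have hij' : i ≠ j := by
      rintro rfl
      let := P.indexNeg
      exact (RootPairing.Base.IsPos.neg_iff_not b i).mp hpos hi
    exact (hij hi).reflectionPerm (b := b.flip) hj hij'


variable {L : Type*} [LieRing L] [LieAlgebra ℂ L] [FiniteDimensional ℂ L]
  [LieAlgebra.IsKilling ℂ L] {H : LieSubalgebra ℂ L} [H.IsCartanSubalgebra]

/-- The dominant integral weights `P⁺`. -/
def IsDominant (b : (rootSystem H).Base) (lam : Dual ℂ H) : Prop :=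
  ∀ i ∈ b.support, ∃ k : ℕ, lam ((rootSystem H).coroot i) = k

/-- The natural number `λ(h_α)`, for `λ` dominant integral and `α` a positive root; see
`coe_ev`. -/
def ev (lam : Dual ℂ H) (α : H.root) : ℕ :=
  ⌊(lam ((rootSystem H).coroot α)).re⌋₊

/-- `λ(h_α)` is indeed a natural number. -/
theorem coe_ev {b : (rootSystem H).Base} {lam : Dual ℂ H} (hlam : IsDominant b lam)
    {α : H.root} (hα : b.IsPos α) :
    (ev lam α : ℂ) = lam ((rootSystem H).coroot α) := by
  suffices ∃ k : ℕ, lam ((rootSystem H).coroot α) = k by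
    obtain ⟨k, hk⟩ := this
    rw [ev, hk, Complex.natCast_re, Nat.floor_natCast]
  obtain ⟨f, hf₀, hf₁, hf₂⟩ := b.flip.exists_root_eq_sum_int α
  have hpos := isPos_flip b hα
  rw [RootPairing.Base.isPos_iff, RootPairing.Base.height_eq_sum hf₂] at hpos
  replace hf₁ : 0 < f := by
    refine hf₁.resolve_right fun hneg => ?_
    exact absurd hpos (not_lt.mpr (Finset.sum_nonpos fun i _ => hneg.le i))
  replace hf₂ : (rootSystem H).coroot α = ∑ j ∈ b.support, f j • (rootSystem H).coroot j := hf₂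
  rw [hf₂, map_sum]
  choose! g hg using hlam
  refine ⟨∑ j ∈ b.support, (f j).toNat * g j, ?_⟩
  push_cast
  refine Finset.sum_congr rfl fun j hj => ?_
  rw [map_zsmul, hg j hj, zsmul_eq_mul]
  congr 1
  have := Int.toNat_of_nonneg (hf₁.le j)
  exact_mod_cast this.symm

/-- The relations `𝔫⁺[t] w = 0`, `(h ⊗ t ^ r) w = δ_{r,0} λ(h) w` and
`(x_i⁻ ⊗ 1) ^ (λ(h_i) + 1) w = 0` of the local Weyl module. Root spaces are one-dimensional, so
that the choice of the root vectors is immaterial. -/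
def localWeylRel (b : (rootSystem H).Base) (lam : Dual ℂ H) : Set (CurrentEnv L) :=
  {u | ∃ α : H.root, b.IsPos α ∧ ∃ x ∈ rootSpace H α.1, ∃ r : ℕ, u = cur x r} ∪
  {u | ∃ (h : H) (r : ℕ),
    u = cur (h : L) r - algebraMap ℂ (CurrentEnv L) (if r = 0 then lam h else 0)} ∪
  {u | ∃ i ∈ b.support, ∃ y ∈ rootSpace H (-i.1), u = cur y 0 ^ (ev lam i + 1)}

/-- The defining relations of `V(λ, μ)`, for `𝔤` simply laced: those of the local Weyl module of
highest weight `λ + μ`, and `(x_α⁻ ⊗ t ^ max {λ(h_α), μ(h_α)}) w = 0` for all `α ∈ R⁺`. -/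
def vRel (b : (rootSystem H).Base) (lam mu : Dual ℂ H) : Set (CurrentEnv L) :=
  localWeylRel b (lam + mu) ∪
  {u | ∃ α : H.root, b.IsPos α ∧ ∃ y ∈ rootSpace H (-α.1),
    u = cur y (max (ev lam α) (ev mu α))}

/-- The defining relations of the level `ℓ` Demazure module `D(ℓ, λ)`, for `𝔤` simply laced
(`d_α = 1` for all `α`): those of the local Weyl module of highest weight `λ`, and
`(x_α⁻ ⊗ t ^ s) w = 0`, `(x_α⁻ ⊗ t ^ (s - 1)) ^ (m + 1) w = 0` for all `α ∈ R⁺`, where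
`λ(h_α) = ℓ (s - 1) + m` with `0 < m ≤ ℓ`. If `λ(h_α) = 0` then `s = 0`, and the second relation
is void. -/
def demazureRel (b : (rootSystem H).Base) (l : ℕ) (lam : Dual ℂ H) : Set (CurrentEnv L) :=
  localWeylRel b lam ∪
  {u | ∃ α : H.root, b.IsPos α ∧ ∃ y ∈ rootSpace H (-α.1), ∃ s m : ℕ,
    0 < m ∧ m ≤ l ∧ ev lam α + l = l * s + m ∧
      (u = cur y s ∨ (0 < s ∧ u = cur y (s - 1) ^ (m + 1)))}

/-- The module `V(λ, μ)`. -/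
abbrev V (b : (rootSystem H).Base) (lam mu : Dual ℂ H) : Type _ := CyclicModule (vRel b lam mu)

/-- The (stable) level `ℓ` Demazure module `D(ℓ, λ)`. -/
abbrev Demazure (b : (rootSystem H).Base) (l : ℕ) (lam : Dual ℂ H) : Type _ :=
  CyclicModule (demazureRel b l lam)

/-- One half of the interlacing condition, for `l i = λ_r(h_i)` and `m i = λ_p(h_i)`: whenever
`λ_r(h_i) = 1 = λ_r(h_j)` with `i < j`, there is `i < s < j` with `λ_p(h_s) = 1`. In type `D_n` the
two end nodes `n - 1`, `n` of the fork are exempt from this, and instead `λ_r(h_{n-1} + h_n) > 0`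
forces `λ_p(h_{n-1} + h_n) = 0`. -/
def Alternates {n : ℕ} (l m : Fin n → ℕ) : SLType → Prop
  | .A => ∀ i j : Fin n, i < j → l i = 1 → l j = 1 → ∃ s, i < s ∧ s < j ∧ m s = 1
  | .D =>
    (0 < ∑ i ∈ Finset.univ.filter (fun i : Fin n => n ≤ (i : ℕ) + 2), l i →
      ∑ i ∈ Finset.univ.filter (fun i : Fin n => n ≤ (i : ℕ) + 2), m i = 0) ∧
    ∀ i j : Fin n, i < j → ¬ ((i : ℕ) + 2 = n ∧ (j : ℕ) + 1 = n) →
      l i = 1 → l j = 1 → ∃ s, i < s ∧ s < j ∧ m s = 1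

/-- Interlacing pairs of dominant weights; `e` labels the simple roots. -/
def IsInterlacing (X : SLType) {b : (rootSystem H).Base} {n : ℕ} (e : Fin n ≃ b.support)
    (lam mu : Dual ℂ H) : Prop :=
  (∀ i, ev (lam + mu) (e i) ≤ 1) ∧
  Alternates (fun i => ev lam (e i)) (fun i => ev mu (e i)) X ∧
  Alternates (fun i => ev mu (e i)) (fun i => ev lam (e i)) X

/-- The vector `(y_α ⊗ t ^ ⌈(λ + μ)(h_α) / 2⌉) w` of `V(λ, μ)`. -/
def kerVec (b : (rootSystem H).Base) (lam mu : Dual ℂ H) (y : H.root → L) (α : H.root) :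
    V b lam mu :=
  cur (y α) ⌈(ev (lam + mu) α : ℚ) / 2⌉₊ • gen (vRel b lam mu)

end Weights

end CurrentAlg

end

/-
Garland's identity, that all coefficients of `(∑ⱼ y ⊗ tʲ uʲ) ^ r` beyond a suitable degree kill the
generator, turns the power relations of the level two Demazure module into consequences of the
linear ones. So the kernel of `V(ν₁, ν₂) → D(2, ν₁ + ν₂)` is generated by the vectors `v_α`, and
`v_α = 0` as soon as `|(ν₁ - ν₂)(h_α)| ≤ 1`, because then the ceiling of half the sum of `ν₁(h_α)`
and `ν₂(h_α)` is their maximum. Call the other positive roots heavy. Along a path in the Dynkin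
diagram, interlacing makes the nonzero values of `ν₁ - ν₂` alternate in sign, so their sum is at
most `1` in absolute value. In type `A` every coroot is such a sum and no root is heavy. In type `D`
the heavy roots are among the `ε_p + ε_q`, and starting from the one with the two largest possible
indices every other one is obtained by successively adding positive roots `δ` with
`(ν₁ - ν₂)(h_δ) = 0`. As `x_δ⁻ ⊗ t ^ ν₁(h_δ)` kills the generator, the commutator of this element
with the one defining `v_β` shows that each such step stays inside `⟨v_β⟩`.
-/

noncomputable section

namespace CurrentAlg

section Commutation

variable {A M : Type*} [Ring A] [AddCommGroup M] [Module A M]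

theorem mul_pow_succ_of_commute {e f k c : A} (he : e * f = f * e + k) (hk : k * f = f * k + c)
    (hc : Commute c f) (r : ℕ) :
    e * f ^ (r + 1) =
      f ^ (r + 1) * e + (r + 1) • (f ^ r * k) + (r + 1).choose 2 • (f ^ (r - 1) * c) := by
  induction r with
  | zero => simp [he]
  | succ r ih =>
    have hcf : (r + 1).choose 2 • (f ^ (r - 1) * c * f) = (r + 1).choose 2 • (f ^ r * c) := by
      rcases r with _ | r
      · simp
      · rw [mul_assoc, hc.eq, ← mul_assoc, Nat.add_sub_cancel, ← pow_succ]
    calc e * f ^ (r + 2)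
      _ = f ^ (r + 1) * (e * f) + (r + 1) • (f ^ r * (k * f)) +
            (r + 1).choose 2 • (f ^ (r - 1) * c * f) := by
        rw [pow_succ, ← mul_assoc, ih, add_mul, add_mul, smul_mul_assoc, smul_mul_assoc,
          mul_assoc, mul_assoc (f ^ r)]
      _ = f ^ (r + 2) * e + (r + 2) • (f ^ (r + 1) * k) +
            (r + 2).choose 2 • (f ^ (r + 1 - 1) * c) := by
        rw [hcf, he, hk, mul_add, mul_add, ← mul_assoc, ← pow_succ, ← mul_assoc (f ^ r),
          ← pow_succ, Nat.choose_succ_succ' (r + 1), Nat.choose_one_right, Nat.add_sub_cancel]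
        module

theorem pow_succ_mul_of_commute {x y z : A} (hz : x * y = y * x + z) (hx : Commute z x) (a : ℕ) :
    x ^ (a + 1) * y = y * x ^ (a + 1) + (a + 1) • (x ^ a * z) := by
  rw [mul_pow_succ_of_commute (k := -z) (c := 0) (by rw [hz]; abel)
    (by rw [neg_mul, hx.eq, mul_neg, add_zero]) (Commute.zero_left x) a]
  simp

variable [IsAddTorsionFree M]

theorem pow_center_smul_eq_zero_of_smul_eq_zero {x y z : A} (hz : x * y = y * x + z)
    (hx : Commute z x) (hy : Commute z y) {a : ℕ} {u : M} (hyu : y • u = 0)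
    (hxu : x ^ a • u = 0) : z ^ a • u = 0 := by
  induction a generalizing u with
  | zero => simpa using hxu
  | succ a ih =>
    have hxzu : (a + 1) • x ^ a • z • u = 0 := by
      have := congrArg (· • u) (pow_succ_mul_of_commute hz hx a)
      simpa only [add_smul, mul_smul, hxu, hyu, smul_zero, zero_add, smul_assoc,
        eq_comm (a := (0 : M))] using this
    rw [pow_succ, mul_smul]
    refine ih ?_ ((smul_eq_zero_iff_right a.succ_ne_zero).mp hxzu)
    rw [← mul_smul, ← hy.eq, mul_smul, hyu, smul_zero]

theorem exists_pow_center_smul_eq_zero {x y z : A} (hz : x * y = y * x + z)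
    (hx : Commute z x) (hy : Commute z y) {a c : ℕ} {w : M} (hxw : x ^ a • w = 0)
    (hyw : y ^ c • w = 0) : ∃ N : ℕ, z ^ N • w = 0 := by
  induction c generalizing a w with
  | zero => exact ⟨0, by simpa using hyw⟩
  | succ c ih =>
    have hxyw : x ^ (a + 1) • y • w = 0 := by
      rw [← mul_smul, pow_succ_mul_of_commute hz hx a, ← (hx.pow_right a).eq, pow_succ']
      simp only [add_smul, mul_smul, smul_assoc, hxw, smul_zero, add_zero]
    obtain ⟨N, hN⟩ := ih hxyw (by rwa [← mul_smul, ← pow_succ])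
    refine ⟨a + N, ?_⟩
    rw [pow_add, mul_smul]
    refine pow_center_smul_eq_zero_of_smul_eq_zero hz hx hy ?_ ?_
    · rw [← mul_smul, ← (hy.pow_left N).eq, mul_smul, hN]
    · rw [← mul_smul, ← (hx.pow_pow N a).eq, mul_smul, hxw, smul_zero]

theorem pow_succ_smul_eq_zero_of_pow_smul_eq_zero {e f h : A} (he : e * f = f * e + h)
    (hh : h * f = f * h - 2 • f) {w : M} {l N : ℕ} (hew : e • w = 0) (hhw : h • w = l • w)
    (hN : f ^ N • w = 0) : f ^ (l + 1) • w = 0 := by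
  have hef (k : ℕ) : e • f ^ (k + 1) • w = ((k + 1) * (l - k) : ℤ) • f ^ k • w := by
    have hff : (k + 1).choose 2 • (f ^ (k - 1) * -(2 • f)) = -(((k + 1) * k) • f ^ k) := by
      rcases k with _ | k
      · simp
      · rw [mul_neg, mul_smul_comm, ← pow_succ, Nat.add_sub_cancel, smul_neg, smul_smul,
          ← Nat.add_one_mul_choose_eq, Nat.choose_one_right]
    have := congrArg (· • w) (mul_pow_succ_of_commute (c := -(2 • f)) he
      (by rw [hh, sub_eq_add_neg]) ((Commute.refl f).smul_left 2).neg_left k)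
    simp only [hff, add_smul, mul_smul, smul_assoc, hew, hhw, smul_zero, zero_add, neg_smul,
      smul_comm (f ^ k) l] at this
    rw [this]
    generalize f ^ k • w = v
    module
  have descent (n : ℕ) (hn : l + 1 ≤ n) : f ^ n • w = 0 → f ^ (l + 1) • w = 0 := by
    induction n, hn using Nat.le_induction with
    | base => exact id
    | succ n hn ih =>
      have hnl : ((n + 1) * (l - n) : ℤ) ≠ 0 := mul_ne_zero (by omega) (by omega)
      exact fun h0 => ih ((smul_eq_zero_iff_right hnl).mp (by rw [← hef, h0, smul_zero]))
  refine descent (N + (l + 1)) (Nat.le_add_left _ _) ?_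
  rw [add_comm, pow_add, mul_smul, hN, smul_zero]

end Commutation

section Garland

open PowerSeries Finset.HasAntidiagonal

variable {A M : Type*} [Ring A] [AddCommGroup M] [Module A M]

/-- The formal derivative on `A⟦X⟧`; Mathlib's `PowerSeries.derivative` requires `A` to be
commutative, and here `A` will be an enveloping algebra. -/
def formalDeriv (f : A⟦X⟧) : A⟦X⟧ := PowerSeries.mk fun n => (n + 1) • coeff (n + 1) f

theorem coeff_formalDeriv (f : A⟦X⟧) (n : ℕ) :
    coeff n (formalDeriv f) = (n + 1) • coeff (n + 1) f := coeff_mk _ _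

theorem formalDeriv_mul (f g : A⟦X⟧) :
    formalDeriv (f * g) = formalDeriv f * g + f * formalDeriv g := by
  ext n
  have hsplit : (n + 1) • coeff (n + 1) (f * g) =
      ∑ p ∈ antidiagonal (n + 1), p.1 • (coeff p.1 f * coeff p.2 g) +
        ∑ p ∈ antidiagonal (n + 1), p.2 • (coeff p.1 f * coeff p.2 g) := by
    rw [coeff_mul, Finset.smul_sum, ← Finset.sum_add_distrib]
    refine Finset.sum_congr rfl fun p hp => ?_
    rw [← add_smul, mem_antidiagonal.mp hp]
  rw [coeff_formalDeriv, hsplit, Finset.Nat.sum_antidiagonal_succ,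
    Finset.Nat.sum_antidiagonal_succ', map_add, coeff_mul, coeff_mul]
  simp only [coeff_formalDeriv, smul_mul_assoc, mul_smul_comm, zero_smul, zero_add]

theorem formalDeriv_pow {f : A⟦X⟧} (h : Commute (formalDeriv f) f) (r : ℕ) :
    formalDeriv (f ^ r) = r • (f ^ (r - 1) * formalDeriv f) := by
  induction r with
  | zero => ext n; simp [coeff_formalDeriv, coeff_one]
  | succ r ih =>
    have hr : r • (f ^ (r - 1) * formalDeriv f * f) = r • (f ^ r * formalDeriv f) := by
      rcases r with _ | r
      · simp
      · rw [mul_assoc, h.eq, ← mul_assoc, Nat.add_sub_cancel, ← pow_succ]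
    rw [pow_succ, formalDeriv_mul, ih, smul_mul_assoc, hr, Nat.add_sub_cancel, succ_nsmul]

theorem commute_of_commute_coeff {f g : A⟦X⟧} (h : ∀ i j, Commute (coeff i f) (coeff j g)) :
    Commute f g := by
  ext n
  rw [coeff_mul, coeff_mul, ← Finset.Nat.sum_antidiagonal_swap]
  exact Finset.sum_congr rfl fun p _ => (h _ _).eq

section

variable {E : A} {Y K : ℕ → A} {w : M}

-- With `Y j = y ⊗ t ^ j`, `K j = h ⊗ t ^ (j + 1)` and `E = x ⊗ t`: on powers of the generating
-- series of `Y` applied to `w`, the operator `E` acts as a multiple of `d/dt`.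
theorem smul_coeff_mk_pow_smul (hY : ∀ i j, Commute (Y i) (Y j))
    (hE : ∀ j, E * Y j = Y j * E + K j)
    (hK : ∀ i j, K i * Y j = Y j * K i - 2 • Y (i + j + 1))
    (hEw : E • w = 0) (hKw : ∀ k, K k • w = 0) (r n : ℕ) :
    E • coeff n (PowerSeries.mk Y ^ (r + 1)) • w =
      -(((r + 1) * (n + 1)) • coeff (n + 1) (PowerSeries.mk Y ^ r) • w) := by
  set f := PowerSeries.mk Y with hf
  set k := PowerSeries.mk K with hk
  have hDf : Commute (formalDeriv f) f := commute_of_commute_coeff fun i j => by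
    rw [coeff_formalDeriv, hf, coeff_mk, coeff_mk]
    exact (hY _ _).smul_left _
  have hEf : C E * f = f * C E + k := by
    ext j
    rw [map_add, coeff_C_mul, coeff_mul_C, hf, hk, coeff_mk, coeff_mk, hE]
  have hkf : k * f = f * k + -(2 • formalDeriv f) := by
    ext j
    have hterm : ∀ p ∈ antidiagonal j, coeff p.1 k * coeff p.2 f =
        coeff p.2 f * coeff p.1 k - 2 • Y (j + 1) := fun p hp => by
      rw [hk, hf, coeff_mk, coeff_mk, hK, mem_antidiagonal.mp hp]
    rw [map_add, map_neg, map_nsmul, coeff_formalDeriv, coeff_mul, coeff_mul,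
      Finset.sum_congr rfl hterm, Finset.sum_sub_distrib, Finset.sum_const,
      Finset.Nat.card_antidiagonal, ← Finset.Nat.sum_antidiagonal_swap, sub_eq_add_neg,
      hf, coeff_mk, smul_comm]
    rfl
  have hEpow : C E * f ^ (r + 1) =
      f ^ (r + 1) * C E + (r + 1) • (f ^ r * k) - (r + 1) • formalDeriv (f ^ r) := by
    rw [mul_pow_succ_of_commute hEf hkf (hDf.smul_left 2).neg_left, formalDeriv_pow hDf, mul_neg,
      smul_neg, mul_smul_comm, smul_smul, smul_smul, ← Nat.add_one_mul_choose_eq,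
      Nat.choose_one_right, sub_eq_add_neg]
  have hkw : coeff n (f ^ r * k) • w = 0 := by
    rw [coeff_mul, Finset.sum_smul]
    refine Finset.sum_eq_zero fun p _ => ?_
    rw [mul_smul, hk, coeff_mk, hKw, smul_zero]
  have := congrArg (fun g => coeff n g • w) hEpow
  simpa only [map_sub, map_add, map_nsmul, coeff_C_mul, coeff_mul_C, coeff_formalDeriv, sub_smul,
    add_smul, mul_smul, smul_assoc, hEw, hkw, smul_zero, zero_add, zero_sub] using this

theorem coeff_mk_pow_smul_eq_zero [IsAddTorsionFree M] (hY : ∀ i j, Commute (Y i) (Y j))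
    (hE : ∀ j, E * Y j = Y j * E + K j)
    (hK : ∀ i j, K i * Y j = Y j * K i - 2 • Y (i + j + 1))
    (hEw : E • w = 0) (hKw : ∀ k, K k • w = 0) {r n : ℕ} (hw : Y 0 ^ (r + n) • w = 0) :
    coeff n (PowerSeries.mk Y ^ r) • w = 0 := by
  induction n generalizing r with
  | zero =>
    rwa [coeff_zero_eq_constantCoeff, map_pow, ← coeff_zero_eq_constantCoeff_apply, coeff_mk]
  | succ n ih =>
    have hr : coeff n (PowerSeries.mk Y ^ (r + 1)) • w = 0 := ih (by rwa [add_right_comm])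
    have h := smul_coeff_mk_pow_smul hY hE hK hEw hKw r n
    rw [hr, smul_zero, eq_comm, neg_eq_zero] at h
    exact (smul_eq_zero_iff_right (by positivity)).mp h

theorem coeff_mk_pow_smul_eq_pow_smul (hY : ∀ i j, Commute (Y i) (Y j)) {d : ℕ}
    (hd : ∀ k, d < k → Y k • w = 0) (r : ℕ) :
    coeff (r * d) (PowerSeries.mk Y ^ r) • w = Y d ^ r • w := by
  set f := PowerSeries.mk Y with hf
  set p : A⟦X⟧ := ((trunc (d + 1) f : A[X]) : A⟦X⟧) with hp
  have hcoeff (n : ℕ) : coeff n (f - p) • w = 0 := by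
    rw [map_sub, hp, Polynomial.coeff_coe, coeff_trunc]
    split_ifs with hn
    · rw [sub_self, zero_smul]
    · rw [sub_zero, hf, coeff_mk, hd n (by omega)]
  have hfp : Commute f p := commute_of_commute_coeff fun i j => by
    rw [hp, Polynomial.coeff_coe, coeff_trunc, hf, coeff_mk]
    split_ifs
    exacts [coeff_mk j Y ▸ hY i j, Commute.zero_right _]
  have hpow : coeff (r * d) (f ^ r - p ^ r) • w = 0 := by
    rw [← hfp.geom_sum₂_mul, coeff_mul, Finset.sum_smul]
    refine Finset.sum_eq_zero fun q _ => ?_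
    rw [mul_smul, hcoeff, smul_zero]
  rw [map_sub, sub_smul, sub_eq_zero] at hpow
  rw [hpow, hp, ← Polynomial.coe_pow, Polynomial.coeff_coe,
    Polynomial.coeff_pow_of_natDegree_le (Nat.le_of_lt_succ (natDegree_trunc_lt f d)), coeff_trunc,
    if_pos d.lt_succ_self, hf, coeff_mk]

theorem pow_smul_eq_zero_of_garland [IsAddTorsionFree M] (hY : ∀ i j, Commute (Y i) (Y j))
    (hE : ∀ j, E * Y j = Y j * E + K j)
    (hK : ∀ i j, K i * Y j = Y j * K i - 2 • Y (i + j + 1))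
    (hEw : E • w = 0) (hKw : ∀ k, K k • w = 0) {l d r : ℕ} (hl : Y 0 ^ (l + 1) • w = 0)
    (hd : ∀ k, d < k → Y k • w = 0) (hr : l < r * (d + 1)) : Y d ^ r • w = 0 := by
  have hw : Y 0 ^ (r + r * d) • w = 0 := by
    rw [add_comm, ← mul_add_one, ← Nat.sub_add_cancel hr, pow_add, mul_smul, hl, smul_zero]
  rw [← coeff_mk_pow_smul_eq_pow_smul hY hd, coeff_mk_pow_smul_eq_zero hY hE hK hEw hKw hw]

end

end Garland

section Cyclic

variable {L : Type*} [LieRing L] [LieAlgebra ℂ L]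

section

attribute [local instance 100] LieRing.ofAssociativeRing

theorem cur_mul_cur (x y : L) (r s : ℕ) :
    cur x r * cur y s = cur y s * cur x r + cur ⁅x, y⁆ (r + s) := by
  rw [add_comm, ← sub_eq_iff_eq_add, ← LieRing.of_associative_ring_bracket, cur, cur, cur,
    ← LieHom.map_lie, ExtendScalars.bracket_tmul, pow_add]

end

theorem cur_zero (r : ℕ) : cur (0 : L) r = 0 := by rw [cur, TensorProduct.tmul_zero, map_zero]

theorem cur_smul (c : ℂ) (x : L) (r : ℕ) : cur (c • x) r = c • cur x r := by
  rw [cur, TensorProduct.tmul_smul, map_smul, cur]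

theorem commute_cur {x y : L} (h : ⁅x, y⁆ = 0) (r s : ℕ) : Commute (cur x r) (cur y s) := by
  rw [Commute, SemiconjBy, cur_mul_cur, h, cur_zero, add_zero]

variable {rel rel' : Set (CurrentEnv L)}

theorem smul_gen_eq_mkQ (u : CurrentEnv L) :
    u • gen rel = (Submodule.span (CurrentEnv L) rel).mkQ u := by
  rw [gen, ← Submodule.Quotient.mk_smul, smul_eq_mul, mul_one, Submodule.mkQ_apply]

theorem smul_gen_eq_zero_iff {u : CurrentEnv L} :
    u • gen rel = 0 ↔ u ∈ Submodule.span (CurrentEnv L) rel := by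
  rw [smul_gen_eq_mkQ, Submodule.mkQ_apply, Submodule.Quotient.mk_eq_zero]

theorem smul_gen_eq_zero {u : CurrentEnv L} (hu : u ∈ rel) : u • gen rel = 0 :=
  smul_gen_eq_zero_iff.mpr (Submodule.subset_span hu)

theorem isGraded_of_map_gen {f : CyclicModule rel →ₗ[CurrentEnv L] CyclicModule rel'}
    (hf : f (gen rel) = gen rel') : IsGraded f := by
  rintro k _ ⟨u, hu, rfl⟩
  refine ⟨u, hu, ?_⟩
  rw [LinearMap.coe_restrictScalars, LinearMap.coe_restrictScalars, ← smul_gen_eq_mkQ,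
    ← smul_gen_eq_mkQ, map_smul, hf]

theorem span_le_span_of_smul_gen_eq_zero (h : ∀ u ∈ rel, u • gen rel' = 0) :
    Submodule.span (CurrentEnv L) rel ≤ Submodule.span (CurrentEnv L) rel' :=
  Submodule.span_le.mpr fun u hu => smul_gen_eq_zero_iff.mp (h u hu)

/-- The homomorphism of cyclic modules sending generator to generator, which exists if the
relations of the source hold in the target. -/
def cyclicMap (h : ∀ u ∈ rel, u • gen rel' = 0) :
    CyclicModule rel →ₗ[CurrentEnv L] CyclicModule rel' :=
  Submodule.factor (span_le_span_of_smul_gen_eq_zero h)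

variable (h : ∀ u ∈ rel, u • gen rel' = 0)

theorem cyclicMap_gen : cyclicMap h (gen rel) = gen rel' := rfl

theorem cyclicMap_surjective : Function.Surjective (cyclicMap h) :=
  Submodule.factor_surjective (span_le_span_of_smul_gen_eq_zero h)

theorem ker_cyclicMap :
    LinearMap.ker (cyclicMap h) = Submodule.span (CurrentEnv L) ((· • gen rel) '' rel') := by
  rw [cyclicMap, Submodule.factor, Submodule.ker_mapQ, Submodule.comap_id, Submodule.map_span]
  exact congrArg _ (Set.image_congr fun u _ => (smul_gen_eq_mkQ u).symm)

end Cyclic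

section Realization

variable {ι κ K M N : Type*} [Field K] [AddCommGroup M] [Module K M] [AddCommGroup N]
  [Module K N] {P : RootPairing ι K M N}

theorem pairing_left_add {i j k : ι} (hk : P.root k = P.root i + P.root j) (l : ι) :
    P.pairing k l = P.pairing i l + P.pairing j l := by
  simp only [← RootPairing.root_coroot_eq_pairing, hk, map_add, LinearMap.add_apply]

section Symmetric

variable [CharZero K] (hsym : ∀ i j, P.pairing i j = P.pairing j i)
include hsym

theorem pairing_eq_neg_one_of_root_eq_add {i j k : ι} (hk : P.root k = P.root i + P.root j) :
    P.pairing i j = -1 := by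
  have hkk := pairing_left_add hk k
  have hki := pairing_left_add hk i
  have hkj := pairing_left_add hk j
  rw [P.pairing_same] at hkk hki hkj
  linear_combination (-hkk - hki - hkj - hsym i k - hsym j k + hsym i j) / 2

theorem coroot_eq_add_of_root_eq_add {i j k : ι} (hk : P.root k = P.root i + P.root j) :
    P.coroot k = P.coroot i + P.coroot j := by
  have hij := pairing_eq_neg_one_of_root_eq_add hsym hk
  obtain rfl : k = P.reflectionPerm j i := P.root.injective <| by
    rw [P.root_reflectionPerm, P.reflection_apply_root, hij, hk]
    module
  rw [P.coroot_reflectionPerm, P.coreflection_apply_coroot, hsym, hij]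
  module

theorem root_ne_add_add {i j k : ι} (hk : P.root k = P.root i + P.root j) (l : ι) :
    P.root l ≠ P.root k + P.root j := by
  intro hl
  have hkj := pairing_eq_neg_one_of_root_eq_add hsym hl
  rw [pairing_left_add hk, pairing_eq_neg_one_of_root_eq_add hsym hk, P.pairing_same] at hkj
  norm_num at hkj

end Symmetric

theorem exists_root_coroot_eq_sum [CharZero K] [Finite ι] [P.IsCrystallographic] [P.IsReduced]
    (b : P.Base) (hsym : ∀ i ∈ b.support, ∀ j ∈ b.support, P.pairing i j = P.pairing j i) (i : ι) :
    ∃ f : ι → ℤ, P.root i = ∑ j ∈ b.support, f j • P.root j ∧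
      P.coroot i = ∑ j ∈ b.support, f j • P.coroot j := by
  classical
  induction i using b.induction_reflect with
  | h₀ i hi =>
    obtain ⟨f, hroot, hcoroot⟩ := hi
    refine ⟨-f, ?_, ?_⟩
    · rw [P.root_reflectionPerm, P.reflection_apply_self, hroot]
      simp
    · rw [P.coroot_reflectionPerm, P.coreflection_apply_self, hcoroot]
      simp
  | h₁ i hi => exact ⟨Pi.single i 1, by simp [Pi.single_apply, hi], by simp [Pi.single_apply, hi]⟩
  | h₂ i j hi hj =>
    obtain ⟨f, hroot, hcoroot⟩ := hi
    have hpairing : P.pairing i j = P.pairing j i := by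
      rw [← P.root_coroot_eq_pairing, ← P.root_coroot_eq_pairing, hroot, hcoroot]
      simp only [map_sum, map_zsmul, LinearMap.sum_apply, LinearMap.smul_apply,
        P.root_coroot_eq_pairing]
      exact Finset.sum_congr rfl fun k hk => by rw [hsym k hk j hj]
    obtain ⟨z, hz⟩ := P.exists_value (S := ℤ) i j
    rw [eq_intCast] at hz
    refine ⟨f - z • Pi.single j 1, ?_, ?_⟩
    · rw [P.root_reflectionPerm, P.reflection_apply_root, ← hz, Int.cast_smul_eq_zsmul, hroot]
      simp [Pi.single_apply, sub_smul, hj]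
    · rw [P.coroot_reflectionPerm, P.coreflection_apply_coroot, ← hpairing, ← hz,
        Int.cast_smul_eq_zsmul, hcoroot]
      simp [Pi.single_apply, sub_smul, hj]

theorem forall_mem_support {b : P.Base} {κ : Type*} (e : κ ≃ b.support) {p : ι → Prop}
    (h : ∀ k, p (e k)) : ∀ i ∈ b.support, p i := fun i hi => by
  simpa only [e.apply_symm_apply] using h (e.symm ⟨i, hi⟩)

variable [Fintype κ] {vec : ι → κ → ℤ}

/-- The integral vectors `vec i` realize the roots of `P` as Euclidean vectors, in such a way that
each coroot corresponds to the same vector as its root. -/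
def IsRealization (P : RootPairing ι K M N) (vec : ι → κ → ℤ) : Prop :=
  ∀ i j, P.pairing i j = ((vec i ⬝ᵥ vec j : ℤ) : K)

theorem exists_isRealization [CharZero K] [Finite ι] [P.IsCrystallographic] [P.IsReduced]
    (b : P.Base) (a : b.support → κ → ℤ)
    (ha : ∀ i j : b.support, P.pairing i j = ((a i ⬝ᵥ a j : ℤ) : K)) :
    ∃ vec : ι → κ → ℤ, IsRealization P vec ∧ ∀ i : b.support, vec i = a i := by
  have hsym : ∀ i ∈ b.support, ∀ j ∈ b.support, P.pairing i j = P.pairing j i :=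
    fun i hi j hj => by rw [ha ⟨i, hi⟩ ⟨j, hj⟩, ha ⟨j, hj⟩ ⟨i, hi⟩, dotProduct_comm]
  choose f hroot hcoroot using exists_root_coroot_eq_sum b hsym
  simp_rw [← Finset.sum_coe_sort b.support] at hroot hcoroot
  set vec : ι → κ → ℤ := fun i => ∑ j : b.support, f i j • a j
  have hvec_simple : ∀ i (j : b.support), P.pairing i j = ((vec i ⬝ᵥ a j : ℤ) : K) := by
    intro i j
    rw [← P.root_coroot_eq_pairing, hroot]
    simp only [vec, map_sum, map_zsmul, LinearMap.sum_apply, LinearMap.smul_apply, ha,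
      P.root_coroot_eq_pairing, sum_dotProduct, smul_dotProduct]
    push_cast
    simp
  have hsimple_vec : ∀ i j : ι, P.pairing i j = ((vec i ⬝ᵥ vec j : ℤ) : K) := by
    intro i j
    rw [← P.root_coroot_eq_pairing, hcoroot]
    simp only [vec, map_sum, map_zsmul, hvec_simple,
      P.root_coroot_eq_pairing, dotProduct_sum, dotProduct_smul]
    push_cast
    simp
  refine ⟨vec, hsimple_vec, fun i => sub_eq_zero.mp (dotProduct_self_eq_zero.mp ?_)⟩
  have hcross : vec i ⬝ᵥ vec i = vec i ⬝ᵥ a i ∧ vec i ⬝ᵥ a i = a i ⬝ᵥ a i := by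
    constructor
    · exact_mod_cast (hsimple_vec i i).symm.trans (hvec_simple i i)
    · exact_mod_cast (hvec_simple i i).symm.trans (ha i i)
  rw [sub_dotProduct, dotProduct_sub, dotProduct_sub, dotProduct_comm (a i) (vec i)]
  omega

namespace IsRealization

variable (hP : IsRealization P vec)
include hP

theorem pairing_comm (i j : ι) : P.pairing i j = P.pairing j i := by
  rw [hP, hP, dotProduct_comm]

theorem exists_root_eq_add {i j : ι} (hij : vec i ⬝ᵥ vec j = -1) :
    ∃ k, P.root k = P.root i + P.root j := by
  refine ⟨P.reflectionPerm j i, ?_⟩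
  rw [P.root_reflectionPerm, P.reflection_apply_root, hP, hij]
  simp

variable [CharZero K]

theorem dotProduct_self (i : ι) : vec i ⬝ᵥ vec i = 2 := by
  exact_mod_cast (hP i i).symm.trans (P.pairing_same i)

theorem vec_eq_sum {s : Finset ι} {f : ι → ℤ} {i : ι}
    (hi : P.root i = ∑ j ∈ s, f j • P.root j) : vec i = ∑ j ∈ s, f j • vec j := by
  have horth : ∀ k, (vec i - ∑ j ∈ s, f j • vec j) ⬝ᵥ vec k = 0 := by
    intro k
    have hik := hP i k
    rw [← P.root_coroot_eq_pairing, hi] at hik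
    simp only [map_sum, map_zsmul, LinearMap.sum_apply, LinearMap.smul_apply,
      P.root_coroot_eq_pairing, hP _ k, zsmul_eq_mul] at hik
    norm_cast at hik
    simp only [sub_dotProduct, sum_dotProduct, smul_dotProduct, smul_eq_mul, hik, sub_self]
  refine sub_eq_zero.mp (dotProduct_self_eq_zero.mp ?_)
  simp only [dotProduct_sub, dotProduct_sum, dotProduct_smul, horth, smul_zero,
    Finset.sum_const_zero, sub_zero]

theorem vec_eq_add {i j k : ι} (hk : P.root k = P.root i + P.root j) :
    vec k = vec i + vec j := by
  classical
  rcases eq_or_ne i j with rfl | hij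
  · have := hP.vec_eq_sum (s := {i}) (f := 2) (i := k) (by simp [hk, two_smul])
    simpa [two_smul] using this
  · have := hP.vec_eq_sum (s := {i, j}) (f := 1) (i := k) (by simp [hk, Finset.sum_pair hij])
    simpa [Finset.sum_pair hij] using this

theorem injective [Finite ι] : Function.Injective vec := by
  intro i j hij
  rw [← P.pairing_two_two_iff, hP, hP, hij, hP.dotProduct_self]
  simp

variable {b : P.Base}

theorem height_eq (η : κ → ℤ) (hη : ∀ i ∈ b.support, vec i ⬝ᵥ η = 1) (i : ι) :
    b.height i = vec i ⬝ᵥ η := by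
  obtain ⟨f, -, -, hroot⟩ := b.exists_root_eq_sum_int i
  rw [b.height_eq_sum hroot, hP.vec_eq_sum hroot, sum_dotProduct]
  refine Finset.sum_congr rfl fun j hj => ?_
  rw [smul_dotProduct, hη j hj, smul_eq_mul, mul_one]

theorem apply_coroot [Finite ι] [P.IsCrystallographic] [P.IsReduced] (φ : N →ₗ[K] K) (G : κ → ℤ)
    (hφ : ∀ i ∈ b.support, φ (P.coroot i) = ((vec i ⬝ᵥ G : ℤ) : K)) (i : ι) :
    φ (P.coroot i) = ((vec i ⬝ᵥ G : ℤ) : K) := by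
  obtain ⟨f, hroot, hcoroot⟩ := exists_root_coroot_eq_sum b (fun i _ j _ => hP.pairing_comm i j) i
  rw [hcoroot, hP.vec_eq_sum hroot, map_sum, sum_dotProduct]
  push_cast
  refine Finset.sum_congr rfl fun j hj => ?_
  rw [map_zsmul, hφ j hj, smul_dotProduct]
  simp

end IsRealization

end Realization

section Interleaving

variable {α : Type*} [LinearOrder α] {s : Finset α} {l m : α → ℕ}

theorem sum_le_sum_add_one_of_interleaved (hl : ∀ i ∈ s, l i ≤ 1)
    (h : ∀ i ∈ s, ∀ j ∈ s, i < j → l i = 1 → l j = 1 → ∃ k ∈ s, i < k ∧ k < j ∧ m k = 1) :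
    ∑ i ∈ s, l i ≤ ∑ i ∈ s, m i + 1 := by
  calc ∑ i ∈ s, l i = (s.filter (l · = 1)).card := by
        rw [Finset.card_filter]
        exact Finset.sum_congr rfl fun i hi => by have := hl i hi; split_ifs <;> omega
    _ ≤ (s.filter (m · = 1)).card + 1 := by
        refine Finset.card_le_of_interleaved fun i hi j hj hij _ => ?_
        rw [Finset.mem_filter] at hi hj
        obtain ⟨k, hk, hik, hkj, hmk⟩ := h i hi.1 j hj.1 hij hi.2 hj.2
        exact ⟨k, Finset.mem_filter.mpr ⟨hk, hmk⟩, hik, hkj⟩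
    _ ≤ ∑ i ∈ s, m i + 1 := by
        rw [Finset.card_filter]
        gcongr with i
        split_ifs <;> omega

theorem abs_sum_sub_le_one_of_interleaved (hlm : ∀ i ∈ s, l i + m i ≤ 1)
    (hl : ∀ i ∈ s, ∀ j ∈ s, i < j → l i = 1 → l j = 1 → ∃ k ∈ s, i < k ∧ k < j ∧ m k = 1)
    (hm : ∀ i ∈ s, ∀ j ∈ s, i < j → m i = 1 → m j = 1 → ∃ k ∈ s, i < k ∧ k < j ∧ l k = 1) :
    |∑ i ∈ s, ((l i : ℤ) - m i)| ≤ 1 := by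
  have hle := sum_le_sum_add_one_of_interleaved (fun i hi => by have := hlm i hi; omega) hl
  have hge := sum_le_sum_add_one_of_interleaved (fun i hi => by have := hlm i hi; omega) hm
  rw [Finset.sum_sub_distrib, ← Nat.cast_sum, ← Nat.cast_sum, abs_le]
  omega

end Interleaving

section NormTwo

variable {κ : Type*} [Fintype κ] [DecidableEq κ] {v : κ → ℤ}

theorem exists_dotProduct_self_sub_single (hv₀ : v ≠ 0) (hv : v ⬝ᵥ v ≤ 2) :
    ∃ p, (v p = 1 ∨ v p = -1) ∧
      (v - Pi.single p (v p)) ⬝ᵥ (v - Pi.single p (v p)) = v ⬝ᵥ v - 1 := by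
  obtain ⟨p, hp⟩ := Function.ne_iff.mp hv₀
  have hsplit : (v - Pi.single p (v p)) ⬝ᵥ (v - Pi.single p (v p)) = v ⬝ᵥ v - v p * v p := by
    simp [sub_dotProduct, dotProduct_sub]
  have hnonneg : 0 ≤ (v - Pi.single p (v p)) ⬝ᵥ (v - Pi.single p (v p)) :=
    Finset.sum_nonneg fun i _ => mul_self_nonneg _
  have hunit : v p = 1 ∨ v p = -1 := by
    have hlt : v p < 2 := by nlinarith
    have hgt : -2 < v p := by nlinarith
    rw [Pi.zero_apply] at hp
    omega
  refine ⟨p, hunit, ?_⟩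
  rw [hsplit]
  rcases hunit with h | h <;> simp [h]

theorem exists_eq_single_add_single [LinearOrder κ] (hv : v ⬝ᵥ v = 2) :
    ∃ p q, p < q ∧ ∃ s t : ℤ, (s = 1 ∨ s = -1) ∧ (t = 1 ∨ t = -1) ∧
      v = Pi.single p s + Pi.single q t := by
  obtain ⟨p, hp, hu⟩ := exists_dotProduct_self_sub_single (v := v) (by rintro rfl; simp at hv)
    hv.le
  set u := v - Pi.single p (v p)
  obtain ⟨q, hq, hw⟩ := exists_dotProduct_self_sub_single (v := u)
    (by intro h; simp [h, hv] at hu) (by omega)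
  have huq : u = Pi.single q (u q) :=
    sub_eq_zero.mp (dotProduct_self_eq_zero.mp (by rw [hw, hu, hv]; rfl))
  have hvpq : v = Pi.single p (v p) + Pi.single q (u q) := by
    rw [← huq]
    exact (add_sub_cancel _ _).symm
  have hpq : p ≠ q := by
    rintro rfl
    simp [u] at hq
  rcases hpq.lt_or_gt with h | h
  · exact ⟨p, q, h, v p, u q, hp, hq, hvpq⟩
  · exact ⟨q, p, h, u q, v p, hq, hp, by rw [add_comm]; exact hvpq⟩

end NormTwo

section TypeA

variable {n : ℕ}

/-- The simple root `ε_k - ε_{k+1}` of type `A_n`. -/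
def simpleVectorA (k : Fin n) : Fin (n + 1) → ℤ :=
  Pi.single k.castSucc 1 - Pi.single k.succ 1

theorem simpleVectorA_dotProduct (k : Fin n) (G : Fin (n + 1) → ℤ) :
    simpleVectorA k ⬝ᵥ G = G k.castSucc - G k.succ := by
  simp [simpleVectorA, sub_dotProduct]

theorem cartanMatrix_A_apply (k l : Fin n) :
    CartanMatrix.A n k l = simpleVectorA k ⬝ᵥ simpleVectorA l := by
  rw [simpleVectorA_dotProduct]
  simp only [simpleVectorA, CartanMatrix.A, Matrix.of_apply, Pi.sub_apply, Pi.single_apply,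
    Fin.ext_iff, Fin.val_castSucc, Fin.val_succ]
  split_ifs <;> omega

/-- The coordinates of a weight of type `A_n` with value `d k` on the simple coroot `k`. -/
def potentialA (d : Fin n → ℤ) (p : Fin (n + 1)) : ℤ :=
  ∑ k with p ≤ Fin.castSucc k, d k

theorem potentialA_sub_potentialA (d : Fin n → ℤ) {p q : Fin (n + 1)} (hpq : p ≤ q) :
    potentialA d p - potentialA d q =
      ∑ k with p ≤ Fin.castSucc k ∧ Fin.castSucc k < q, d k := by
  simp only [potentialA, Finset.sum_filter, ← Finset.sum_sub_distrib]
  refine Finset.sum_congr rfl fun k _ => ?_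
  by_cases hq : q ≤ k.castSucc
  · simp [hq, hpq.trans hq]
  · simp [hq, not_le.mp hq]

theorem simpleVectorA_dotProduct_potentialA (d : Fin n → ℤ) (k : Fin n) :
    simpleVectorA k ⬝ᵥ potentialA d = d k := by
  have hpath : Finset.univ.filter
      (fun j : Fin n => k.castSucc ≤ j.castSucc ∧ j.castSucc < k.succ) = {k} := by
    ext j
    simp only [Finset.mem_filter, Finset.mem_univ, true_and, Finset.mem_singleton, Fin.ext_iff,
      Fin.le_def, Fin.lt_def, Fin.val_castSucc, Fin.val_succ]
    omega
  rw [simpleVectorA_dotProduct, potentialA_sub_potentialA d k.castSucc_le_succ, hpath,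
    Finset.sum_singleton]

theorem abs_sum_le_one_of_alternates_A {l m : Fin n → ℕ} (hlm : ∀ k, l k + m k ≤ 1)
    (hl : Alternates l m .A) (hm : Alternates m l .A) (p q : Fin (n + 1)) :
    |∑ k with p ≤ Fin.castSucc k ∧ Fin.castSucc k < q, ((l k : ℤ) - m k)| ≤ 1 := by
  have hmem : ∀ {l m : Fin n → ℕ}, Alternates l m .A →
      ∀ i ∈ Finset.univ.filter (fun k : Fin n => p ≤ k.castSucc ∧ k.castSucc < q),
      ∀ j ∈ Finset.univ.filter (fun k : Fin n => p ≤ k.castSucc ∧ k.castSucc < q),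
      i < j → l i = 1 → l j = 1 →
      ∃ k ∈ Finset.univ.filter (fun k : Fin n => p ≤ k.castSucc ∧ k.castSucc < q),
        i < k ∧ k < j ∧ m k = 1 := by
    intro l m h i hi j hj hij hli hlj
    obtain ⟨k, hik, hkj, hk⟩ := h i j hij hli hlj
    rw [Finset.mem_filter_univ] at hi hj
    refine ⟨k, ?_, hik, hkj, hk⟩
    rw [Finset.mem_filter_univ]
    exact ⟨hi.1.trans (Fin.castSucc_le_castSucc_iff.mpr hik.le),
      (Fin.castSucc_lt_castSucc_iff.mpr hkj).trans hj.2⟩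
  exact abs_sum_sub_le_one_of_interleaved (fun k _ => hlm k) (hmem hl) (hmem hm)

variable {ι K M N : Type*} [Field K] [CharZero K] [AddCommGroup M] [Module K M] [AddCommGroup N]
  [Module K N] [Finite ι] {P : RootPairing ι K M N} [P.IsCrystallographic] [P.IsReduced]
  {b : P.Base} {e : Fin n ≃ b.support}

theorem exists_isRealization_A
    (he : ∀ k l, P.pairing (e k) (e l) = ((CartanMatrix.A n k l : ℤ) : K)) :
    ∃ vec, IsRealization P vec ∧ ∀ k, vec (e k) = simpleVectorA k := by
  obtain ⟨vec, hP, hvec⟩ := exists_isRealization b (fun j => simpleVectorA (e.symm j))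
    (fun i j => by simpa [cartanMatrix_A_apply] using he (e.symm i) (e.symm j))
  exact ⟨vec, hP, fun k => by rw [hvec, e.symm_apply_apply]⟩

theorem abs_le_one_of_alternates_A
    (he : ∀ k l, P.pairing (e k) (e l) = ((CartanMatrix.A n k l : ℤ) : K)) {φ : N →ₗ[K] K}
    {l m : Fin n → ℕ} (hlm : ∀ k, l k + m k ≤ 1) (hl : Alternates l m .A)
    (hm : Alternates m l .A)
    (hφ : ∀ k, φ (P.coroot (e k)) = (((l k : ℤ) - m k : ℤ) : K))
    {i : ι} {c : ℤ} (hc : φ (P.coroot i) = c) : |c| ≤ 1 := by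
  obtain ⟨vec, hP, hvec⟩ := exists_isRealization_A he
  set d : Fin n → ℤ := fun k => (l k : ℤ) - m k
  have hcG : c = vec i ⬝ᵥ potentialA d := by
    have := hP.apply_coroot (b := b) φ (potentialA d) (forall_mem_support e fun k => by
      rw [hvec, simpleVectorA_dotProduct_potentialA, hφ]) i
    exact_mod_cast hc.symm.trans this
  have hsum : vec i ⬝ᵥ 1 = 0 := by
    have := hP.apply_coroot (b := b) 0 1 (forall_mem_support e fun k => by
      rw [hvec, simpleVectorA_dotProduct]
      simp) i
    exact_mod_cast this.symm.trans (LinearMap.zero_apply _)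
  obtain ⟨p, q, hpq, s, t, hs, ht, hpq_eq⟩ := exists_eq_single_add_single (hP.dotProduct_self i)
  have hbound := abs_sum_le_one_of_alternates_A hlm hl hm p q
  rw [← potentialA_sub_potentialA d hpq.le, abs_le] at hbound
  rw [hpq_eq] at hcG hsum
  simp only [add_dotProduct, single_dotProduct, Pi.one_apply, mul_one] at hcG hsum
  rw [abs_le]
  rcases hs with rfl | rfl <;> rcases ht with rfl | rfl <;> omega

end TypeA

section TypeD

variable {m : ℕ}

/-- The simple root `k` of type `D_{m+2}`: `ε_k - ε_{k+1}`, or `ε_m + ε_{m+1}` for the last node. -/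
def simpleVectorD (k : Fin (m + 2)) : Fin (m + 2) → ℤ :=
  Fin.lastCases (Pi.single (Fin.last m).castSucc 1 + Pi.single (Fin.last (m + 1)) 1)
    (fun k => Pi.single k.castSucc 1 - Pi.single k.succ 1) k

theorem simpleVectorD_castSucc (k : Fin (m + 1)) :
    simpleVectorD k.castSucc = Pi.single k.castSucc 1 - Pi.single k.succ 1 := by
  simp [simpleVectorD]

theorem simpleVectorD_last : simpleVectorD (Fin.last (m + 1)) =
    Pi.single (Fin.last m).castSucc 1 + Pi.single (Fin.last (m + 1)) 1 := by
  simp [simpleVectorD]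

theorem cartanMatrix_D_apply (hm : 1 ≤ m) (k l : Fin (m + 2)) :
    CartanMatrix.D (m + 2) k l = simpleVectorD k ⬝ᵥ simpleVectorD l := by
  induction k using Fin.lastCases <;> induction l using Fin.lastCases <;>
  · simp only [simpleVectorD_castSucc, simpleVectorD_last, sub_dotProduct, add_dotProduct,
      single_dotProduct, CartanMatrix.D, Matrix.of_apply, Pi.sub_apply, Pi.add_apply,
      Pi.single_apply, Fin.ext_iff, Fin.val_castSucc, Fin.val_succ, Fin.val_last, or_true,
      and_true]
    split_ifs <;> omega

/-- The nodes on the path from `p` to `c` in the Dynkin diagram of type `D_{m+2}`. -/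
def pathD (p c : Fin (m + 2)) : Finset (Fin (m + 2)) :=
  {k | p ≤ k ∧ k ≤ c ∧ ((k : ℕ) < m ∨ k = c)}

theorem mem_pathD {p c k : Fin (m + 2)} :
    k ∈ pathD p c ↔ p ≤ k ∧ k ≤ c ∧ ((k : ℕ) < m ∨ k = c) :=
  Finset.mem_filter_univ k

/-- Twice the coordinates of a weight of type `D_{m+2}` with value `d k` on the simple coroot
`k`. -/
def potentialD (d : Fin (m + 2) → ℤ) (p : Fin (m + 2)) : ℤ :=
  if p = Fin.last (m + 1) then d (Fin.last (m + 1)) - d (Fin.last m).castSucc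
  else 2 * (∑ k with p ≤ k ∧ (k : ℕ) < m, d k) + d (Fin.last m).castSucc + d (Fin.last (m + 1))

theorem sum_pathD (d : Fin (m + 2) → ℤ) {p c : Fin (m + 2)} (hpc : p ≤ c) (hc : m ≤ c) :
    ∑ k ∈ pathD p c, d k = ∑ k with p ≤ k ∧ (k : ℕ) < m, d k + d c := by
  have hpath : pathD p c =
      insert c (Finset.univ.filter fun k : Fin (m + 2) => p ≤ k ∧ (k : ℕ) < m) := by
    ext k
    simp only [mem_pathD, Finset.mem_insert, Finset.mem_filter_univ, Fin.le_def, Fin.ext_iff] at *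
    omega
  rw [hpath, Finset.sum_insert (by simp [hc]), add_comm]

theorem potentialD_sub_potentialD (d : Fin (m + 2) → ℤ) {p : Fin (m + 2)} {c : Fin (m + 1)}
    (hpc : p ≤ c.castSucc) :
    potentialD d p - potentialD d c.succ = 2 * ∑ k ∈ pathD p c.castSucc, d k := by
  have hp : p ≠ Fin.last (m + 1) := (hpc.trans_lt c.castSucc_lt_last).ne
  rw [potentialD, if_neg hp, potentialD]
  split_ifs with hc
  · obtain rfl : c = Fin.last m := Fin.succ_inj.mp hc
    rw [sum_pathD d hpc (by simp)]
    ring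
  · have hcm : (c : ℕ) < m := by
      rw [Fin.ext_iff, Fin.val_succ, Fin.val_last] at hc
      omega
    have hpath : ∑ k ∈ pathD p c.castSucc, d k =
        ∑ k with p ≤ k ∧ (k : ℕ) < m, d k - ∑ k with c.succ ≤ k ∧ (k : ℕ) < m, d k := by
      simp only [pathD, Finset.sum_filter, ← Finset.sum_sub_distrib]
      refine Finset.sum_congr rfl fun k _ => ?_
      simp only [Fin.le_def, Fin.ext_iff, Fin.val_castSucc, Fin.val_succ] at hpc ⊢
      split_ifs <;> omega
    rw [hpath]
    ring

theorem potentialD_add_potentialD_last (d : Fin (m + 2) → ℤ) {p : Fin (m + 2)}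
    (hp : p < Fin.last (m + 1)) :
    potentialD d p + potentialD d (Fin.last (m + 1)) =
      2 * ∑ k ∈ pathD p (Fin.last (m + 1)), d k := by
  rw [sum_pathD d hp.le (by simp), potentialD, if_neg hp.ne, potentialD, if_pos rfl]
  ring

theorem simpleVectorD_dotProduct_potentialD (d : Fin (m + 2) → ℤ) (k : Fin (m + 2)) :
    simpleVectorD k ⬝ᵥ potentialD d = 2 * d k := by
  have hpath : ∀ p c : Fin (m + 2), m ≤ (p : ℕ) → p ≤ c → pathD p c = {c} := by
    intro p c hp hpc
    ext k
    simp only [mem_pathD, Finset.mem_singleton, Fin.le_def, Fin.ext_iff] at *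
    omega
  induction k using Fin.lastCases with
  | last =>
    simp only [simpleVectorD_last, add_dotProduct, single_dotProduct, one_mul]
    rw [potentialD_add_potentialD_last d (Fin.castSucc_lt_last _),
      hpath _ _ (by simp) (Fin.le_last _), Finset.sum_singleton]
  | cast k =>
    have hself : pathD k.castSucc k.castSucc = {k.castSucc} := by
      ext j
      simp only [mem_pathD, Finset.mem_singleton, Fin.le_def, Fin.ext_iff]
      omega
    simp only [simpleVectorD_castSucc, sub_dotProduct, single_dotProduct, one_mul]
    rw [potentialD_sub_potentialD d le_rfl, hself, Finset.sum_singleton]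

theorem Alternates.eq_zero_of_fork {l r : Fin (m + 2) → ℕ} (h : Alternates l r .D)
    {i j : Fin (m + 2)} (hi : m ≤ i) (hj : m ≤ j) (hli : l i = 1) : r j = 0 := by
  have hfork : ∀ k : Fin (m + 2), m ≤ k →
      k ∈ Finset.univ.filter fun k : Fin (m + 2) => m + 2 ≤ (k : ℕ) + 2 :=
    fun k hk => (Finset.mem_filter_univ k).mpr (by omega)
  have hpos : 0 < ∑ k ∈ Finset.univ.filter (fun k : Fin (m + 2) => m + 2 ≤ (k : ℕ) + 2), l k :=
    Finset.sum_pos' (fun _ _ => Nat.zero_le _) ⟨i, hfork i hi, by omega⟩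
  exact Finset.sum_eq_zero_iff.mp (h.1 hpos) j (hfork j hj)

theorem Alternates.exists_mem_pathD {l r : Fin (m + 2) → ℕ} (h : Alternates l r .D)
    {p c i j : Fin (m + 2)} (hi : i ∈ pathD p c) (hj : j ∈ pathD p c) (hij : i < j)
    (hli : l i = 1) (hlj : l j = 1) : ∃ k ∈ pathD p c, i < k ∧ k < j ∧ r k = 1 := by
  simp only [mem_pathD, Fin.le_def, Fin.ext_iff] at hi hj ⊢
  obtain ⟨k, hik, hkj, hrk⟩ := h.2 i j hij (by omega) hli hlj
  have hkm : (k : ℕ) < m := by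
    by_contra! hmk
    have := h.eq_zero_of_fork (hmk.trans (Fin.lt_def.mp hkj).le) hmk hlj
    omega
  rw [Fin.lt_def] at hik hkj
  exact ⟨k, by omega, hik, hkj, hrk⟩

theorem abs_sum_pathD_le_one {l r : Fin (m + 2) → ℕ} (hlr : ∀ k, l k + r k ≤ 1)
    (hl : Alternates l r .D) (hr : Alternates r l .D) (p c : Fin (m + 2)) :
    |∑ k ∈ pathD p c, ((l k : ℤ) - r k)| ≤ 1 :=
  abs_sum_sub_le_one_of_interleaved (fun k _ => hlr k)
    (fun _ hi _ hj => hl.exists_mem_pathD hi hj) (fun _ hi _ hj => hr.exists_mem_pathD hi hj)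

end TypeD

section NullRoots

variable {ι K M N : Type*} [Field K] [CharZero K] [AddCommGroup M] [Module K M] [AddCommGroup N]
  [Module K N] {P : RootPairing ι K M N}

/-- `γ` arises from the positive root `β` by adding a positive root at which `d` vanishes. -/
def AddNullRoot (b : P.Base) (d : ι → ℤ) (β γ : ι) : Prop :=
  ∃ δ, b.IsPos β ∧ b.IsPos δ ∧ d δ = 0 ∧ P.root γ = P.root β + P.root δ

/-- Each positive root `γ` with `1 < |d γ|` arises from the positive root `β` by successively adding
positive roots at which `d` vanishes, and `β` has smaller height than any other such `γ`. -/
def IsHeavyRootSource (b : P.Base) (d : ι → ℤ) (β : ι) : Prop :=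
  b.IsPos β ∧ ∀ γ, b.IsPos γ → 1 < |d γ| →
    (γ ≠ β → b.height β < b.height γ) ∧ Relation.ReflTransGen (AddNullRoot b d) β γ

end NullRoots

section RootsD

theorem exists_greatest_pair {α : Type*} [LinearOrder α] [Finite α] {S : Set α}
    (hS : ∃ p ∈ S, ∃ q ∈ S, p < q) :
    ∃ p₀ q₀, p₀ < q₀ ∧ p₀ ∈ S ∧ q₀ ∈ S ∧ ∀ p ∈ S, ∀ q ∈ S, p < q → p ≤ p₀ ∧ q ≤ q₀ := by
  obtain ⟨p, hp, q, hq, hpq⟩ := hS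
  obtain ⟨q₀, hq₀, hq₀_max⟩ := S.toFinite.exists_maximal ⟨q, hq⟩
  have hle : ∀ q ∈ S, q ≤ q₀ := fun q hq => le_of_not_gt fun hlt => hlt.not_ge (hq₀_max hq hlt.le)
  obtain ⟨p₀, ⟨hp₀, hpq₀⟩, hp₀_max⟩ :=
    (S ∩ Set.Iio q₀).toFinite.exists_maximal ⟨p, hp, hpq.trans_le (hle q hq)⟩
  refine ⟨p₀, q₀, hpq₀, hp₀, hq₀, fun p hp q hq hpq => ⟨le_of_not_gt fun hlt => ?_, hle q hq⟩⟩
  exact hlt.not_ge (hp₀_max ⟨hp, hpq.trans_le (hle q hq)⟩ hlt.le)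

theorem eq_of_abs_eq_two {κ : Type*} [LinearOrder κ] {G : κ → ℤ}
    (hsub : ∀ p q, p < q → |G p - G q| ≤ 2) {p q : κ} (hp : |G p| = 2) (hq : |G q| = 2) :
    G p = G q := by
  rw [abs_eq zero_le_two] at hp hq
  rcases lt_trichotomy p q with hlt | rfl | hlt
  · have := abs_le.mp (hsub _ _ hlt)
    omega
  · rfl
  · have := abs_le.mp (hsub _ _ hlt)
    omega

variable {m : ℕ} {ι K M N : Type*} [Field K] [CharZero K] [AddCommGroup M] [Module K M]
  [AddCommGroup N] [Module K N] {P : RootPairing ι K M N} {b : P.Base}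
  {e : Fin (m + 2) ≃ b.support} {vec : ι → Fin (m + 2) → ℤ}

section Existence

variable (hP : IsRealization P vec) (hvec : ∀ k, vec (e k) = simpleVectorD k)
include hP hvec

theorem exists_vec_eq_single_sub_single {p q : Fin (m + 2)} (hpq : p < q) :
    ∃ i, vec i = Pi.single p 1 - Pi.single q 1 := by
  induction q using Fin.induction with
  | zero => exact absurd hpq (Fin.not_lt_zero p)
  | succ q ih =>
    have hq : vec (e q.castSucc) = Pi.single q.castSucc 1 - Pi.single q.succ 1 := by
      rw [hvec, simpleVectorD_castSucc]
    rcases (Fin.le_castSucc_iff.mpr hpq).eq_or_lt with rfl | hlt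
    · exact ⟨_, hq⟩
    · obtain ⟨i, hi⟩ := ih hlt
      obtain ⟨k, hk⟩ := hP.exists_root_eq_add (i := i) (j := e q.castSucc) (by
        rw [hi, hq]
        simp [hpq.ne, hlt.ne, q.castSucc_lt_succ.ne'])
      exact ⟨k, by rw [hP.vec_eq_add hk, hi, hq, sub_add_sub_cancel]⟩

theorem exists_vec_eq_single_add_single {p q : Fin (m + 2)} (hpq : p < q)
    (hq : q < Fin.last (m + 1)) : ∃ i, vec i = Pi.single p 1 + Pi.single q 1 := by
  have hp := hpq.trans hq
  have hlast : vec (e (Fin.last (m + 1))) =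
      Pi.single (Fin.last m).castSucc 1 + Pi.single (Fin.last (m + 1)) 1 := by
    rw [hvec, simpleVectorD_last]
  have hpm : p < (Fin.last m).castSucc := by
    rw [Fin.lt_def] at *
    simp only [Fin.val_castSucc, Fin.val_last] at *
    omega
  obtain ⟨i, hi⟩ := exists_vec_eq_single_sub_single hP hvec hp
  obtain ⟨j, hj⟩ := hP.exists_root_eq_add (i := i) (j := e (Fin.last (m + 1))) (by
    rw [hi, hlast]
    simp [hp.ne, hpm.ne])
  have hj_vec : vec j = Pi.single p 1 + Pi.single (Fin.last m).castSucc 1 := by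
    rw [hP.vec_eq_add hj, hi, hlast]
    abel
  rcases (Fin.le_castSucc_iff.mpr hq : q ≤ (Fin.last m).castSucc).eq_or_lt with rfl | hqm
  · exact ⟨j, hj_vec⟩
  · obtain ⟨k, hk⟩ := exists_vec_eq_single_sub_single hP hvec hqm
    obtain ⟨l, hl⟩ := hP.exists_root_eq_add (i := j) (j := k) (by
      rw [hj_vec, hk]
      simp [hpq.ne, hpm.ne, hqm.ne'])
    refine ⟨l, ?_⟩
    rw [hP.vec_eq_add hl, hj_vec, hk]
    abel

end Existence

/-- The height of `ε_p` in type `D_{m+2}`. -/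
def heightD (p : Fin (m + 2)) : ℤ := m + 1 - p

theorem simpleVectorD_dotProduct_heightD (k : Fin (m + 2)) : simpleVectorD k ⬝ᵥ heightD = 1 := by
  induction k using Fin.lastCases <;>
  simp [simpleVectorD_last, simpleVectorD_castSucc, sub_dotProduct, add_dotProduct, heightD]

variable (hP : IsRealization P vec) (hvec : ∀ k, vec (e k) = simpleVectorD k)
include hP hvec

theorem height_eq_dotProduct_heightD (i : ι) : b.height i = vec i ⬝ᵥ heightD :=
  hP.height_eq heightD (forall_mem_support e fun k => by
    rw [hvec, simpleVectorD_dotProduct_heightD]) i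

theorem isPos_of_vec_eq_single_sub_single {p q : Fin (m + 2)} (hpq : p < q) {i : ι}
    (hi : vec i = Pi.single p 1 - Pi.single q 1) : b.IsPos i := by
  rw [RootPairing.Base.isPos_iff, height_eq_dotProduct_heightD hP hvec, hi]
  simp only [sub_dotProduct, single_dotProduct, heightD]
  omega

theorem isPos_of_vec_eq_single_add_single {p q : Fin (m + 2)} (hpq : p < q) {i : ι}
    (hi : vec i = Pi.single p 1 + Pi.single q 1) : b.IsPos i := by
  rw [RootPairing.Base.isPos_iff, height_eq_dotProduct_heightD hP hvec, hi]
  simp only [add_dotProduct, single_dotProduct, heightD]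
  omega

theorem vec_eq_of_isPos {i : ι} (hi : b.IsPos i) : ∃ p q, p < q ∧
    (vec i = Pi.single p 1 - Pi.single q 1 ∨ vec i = Pi.single p 1 + Pi.single q 1) := by
  rw [RootPairing.Base.isPos_iff, height_eq_dotProduct_heightD hP hvec] at hi
  obtain ⟨p, q, hpq, s, t, hs, ht, hst⟩ := exists_eq_single_add_single (hP.dotProduct_self i)
  obtain rfl : s = 1 := by
    rw [hst] at hi
    simp only [add_dotProduct, single_dotProduct, heightD] at hi
    rcases hs with rfl | rfl
    · rfl
    · rcases ht with rfl | rfl <;> omega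
  refine ⟨p, q, hpq, ht.symm.imp ?_ ?_⟩ <;> rintro rfl
  · rw [hst, Pi.single_neg, sub_eq_add_neg]
  · exact hst

theorem height_lt_height_of_le [Finite ι] {p p' q q' : Fin (m + 2)}
    (hp : p ≤ p') (hq : q ≤ q') {β γ : ι} (hβ : vec β = Pi.single p' 1 + Pi.single q' 1)
    (hγ : vec γ = Pi.single p 1 + Pi.single q 1) (hne : β ≠ γ) : b.height β < b.height γ := by
  have hlt : p < p' ∨ q < q' := by
    by_contra! hle
    obtain rfl := hp.antisymm hle.1
    obtain rfl := hq.antisymm hle.2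
    exact hne (hP.injective (hβ.trans hγ.symm))
  rw [height_eq_dotProduct_heightD hP hvec, height_eq_dotProduct_heightD hP hvec, hβ, hγ]
  simp only [add_dotProduct, single_dotProduct, heightD]
  simp only [Fin.lt_def, Fin.le_def] at hlt hp hq
  omega

variable {G : Fin (m + 2) → ℤ} {d : ι → ℤ}
  (hd : ∀ i, b.IsPos i → 2 * d i = vec i ⬝ᵥ G)
include hd

theorem reflTransGen_addNullRoot [Finite ι] {p p' r : Fin (m + 2)}
    (hpp : p ≤ p') (hr : p ≠ r) (hr' : p' ≠ r) (hG : G p = G p') {β γ : ι} (hβ : b.IsPos β)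
    (hβ_vec : vec β = Pi.single p' 1 + Pi.single r 1)
    (hγ_vec : vec γ = Pi.single p 1 + Pi.single r 1) :
    Relation.ReflTransGen (AddNullRoot b d) β γ := by
  rcases hpp.eq_or_lt with rfl | hlt
  · obtain rfl := hP.injective (hβ_vec.trans hγ_vec.symm)
    exact .refl
  obtain ⟨δ, hδ_vec⟩ := exists_vec_eq_single_sub_single hP hvec hlt
  have hδ := isPos_of_vec_eq_single_sub_single hP hvec hlt hδ_vec
  obtain ⟨k, hk⟩ := hP.exists_root_eq_add (i := β) (j := δ) (by
    rw [hβ_vec, hδ_vec]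
    simp [hlt.ne', hr.symm, hr'.symm])
  obtain rfl : k = γ := hP.injective <| by
    rw [hP.vec_eq_add hk, hβ_vec, hδ_vec, hγ_vec]
    abel
  refine .single ⟨δ, hβ, hδ, ?_, hk⟩
  have := hd δ hδ
  simp only [hδ_vec, sub_dotProduct, single_dotProduct, hG, sub_self] at this
  omega

variable (hsub : ∀ p q, p < q → |G p - G q| ≤ 2)
  (hadd : ∀ p, p < Fin.last (m + 1) → |G p + G (Fin.last (m + 1))| ≤ 2)
include hsub hadd

theorem exists_vec_eq_of_one_lt_abs {γ : ι} (hγ : b.IsPos γ) (hlt : 1 < |d γ|) :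
    ∃ p q, p < q ∧ q < Fin.last (m + 1) ∧ |G p| = 2 ∧ G q = G p ∧
      vec γ = Pi.single p 1 + Pi.single q 1 := by
  have hdγ := hd γ hγ
  obtain ⟨p, q, hpq, hγ_vec⟩ := vec_eq_of_isPos hP hvec hγ
  have hpq_le := abs_le.mp (hsub p q hpq)
  rw [lt_abs] at hlt
  rcases hγ_vec with hγ_vec | hγ_vec <;> rw [hγ_vec] at hdγ <;>
    simp only [sub_dotProduct, add_dotProduct, single_dotProduct, one_mul] at hdγ
  · omega
  have hq : q < Fin.last (m + 1) := by
    refine (Fin.le_last q).lt_of_ne ?_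
    rintro rfl
    have := abs_le.mp (hadd p hpq)
    omega
  have hp_sub := abs_le.mp (hsub p _ (hpq.trans hq))
  have hp_add := abs_le.mp (hadd p (hpq.trans hq))
  have hq_sub := abs_le.mp (hsub q _ hq)
  have hq_add := abs_le.mp (hadd q hq)
  refine ⟨p, q, hpq, hq, ?_, by omega, hγ_vec⟩
  rw [abs_eq zero_le_two]
  omega

theorem exists_isHeavyRootSource_of_abs_le_two [Finite ι] : ∃ β, IsHeavyRootSource b d β := by
  have heavy : ∀ γ, b.IsPos γ → 1 < |d γ| → ∃ p q, p < q ∧ q < Fin.last (m + 1) ∧ |G p| = 2 ∧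
      G q = G p ∧ vec γ = Pi.single p 1 + Pi.single q 1 :=
    fun γ hγ => exists_vec_eq_of_one_lt_abs hP hvec hd hsub hadd hγ
  by_cases hne : ∃ γ, b.IsPos γ ∧ 1 < |d γ|
  swap
  · exact ⟨e 0, RootPairing.Base.isPos_of_mem_support (e 0).2,
      fun γ hγ hdγ => absurd ⟨γ, hγ, hdγ⟩ hne⟩
  obtain ⟨p₀, q₀, hpq₀, ⟨-, hGp₀⟩, ⟨hq₀, hGq₀⟩, hmax⟩ :=
    exists_greatest_pair (S := {p | p < Fin.last (m + 1) ∧ |G p| = 2}) (by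
      obtain ⟨γ, hγ, hdγ⟩ := hne
      obtain ⟨p, q, hpq, hq, hGp, hGq, -⟩ := heavy γ hγ hdγ
      exact ⟨p, ⟨hpq.trans hq, hGp⟩, q, ⟨hq, by rw [hGq, hGp]⟩, hpq⟩)
  obtain ⟨β, hβ_vec⟩ := exists_vec_eq_single_add_single hP hvec hpq₀ hq₀
  have hβ := isPos_of_vec_eq_single_add_single hP hvec hpq₀ hβ_vec
  refine ⟨β, hβ, fun γ hγ hdγ => ?_⟩
  obtain ⟨p, q, hpq, hq, hGp, hGq, hγ_vec⟩ := heavy γ hγ hdγ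
  obtain ⟨hpp₀, hqq₀⟩ := hmax p ⟨hpq.trans hq, hGp⟩ q ⟨hq, by rw [hGq, hGp]⟩ hpq
  have hpq₀' := hpp₀.trans_lt hpq₀
  constructor
  · exact fun hne => height_lt_height_of_le hP hvec hpp₀ hqq₀ hβ_vec hγ_vec hne.symm
  · obtain ⟨α, hα_vec⟩ := exists_vec_eq_single_add_single hP hvec hpq₀' hq₀
    have hα := isPos_of_vec_eq_single_add_single hP hvec hpq₀' hα_vec
    have hG_p := eq_of_abs_eq_two hsub hGp hGp₀
    have hG_q := eq_of_abs_eq_two hsub (by rw [hGq, hGp]) hGq₀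
    refine (reflTransGen_addNullRoot hP hvec hd hpp₀ hpq₀'.ne hpq₀.ne hG_p hβ hβ_vec
      hα_vec).trans ?_
    rw [add_comm (Pi.single p 1)] at hα_vec hγ_vec
    exact reflTransGen_addNullRoot hP hvec hd hqq₀ hpq.ne' hpq₀'.ne' hG_q hα hα_vec hγ_vec

end RootsD

section Alternation

variable {ι K M N : Type*} [Field K] [CharZero K] [AddCommGroup M] [Module K M] [AddCommGroup N]
  [Module K N] [Finite ι] {P : RootPairing ι K M N} [P.IsCrystallographic] [P.IsReduced]
  {b : P.Base}

theorem exists_isRealization_D {m : ℕ} {e : Fin (m + 2) ≃ b.support} (hm : 1 ≤ m)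
    (he : ∀ k l, P.pairing (e k) (e l) = ((CartanMatrix.D (m + 2) k l : ℤ) : K)) :
    ∃ vec, IsRealization P vec ∧ ∀ k, vec (e k) = simpleVectorD k := by
  obtain ⟨vec, hP, hvec⟩ := exists_isRealization b (fun j => simpleVectorD (e.symm j))
    (fun i j => by simpa [cartanMatrix_D_apply hm] using he (e.symm i) (e.symm j))
  exact ⟨vec, hP, fun k => by rw [hvec, e.symm_apply_apply]⟩

theorem exists_isHeavyRootSource_D {m : ℕ} {e : Fin (m + 2) ≃ b.support} (hm : 1 ≤ m)
    (he : ∀ k l, P.pairing (e k) (e l) = ((CartanMatrix.D (m + 2) k l : ℤ) : K))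
    {l r : Fin (m + 2) → ℕ} (hlr : ∀ k, l k + r k ≤ 1) (hl : Alternates l r .D)
    (hr : Alternates r l .D) {φ : N →ₗ[K] K} {d : ι → ℤ}
    (hd : ∀ i, b.IsPos i → φ (P.coroot i) = d i) (hde : ∀ k, d (e k) = (l k : ℤ) - r k) :
    ∃ β, IsHeavyRootSource b d β := by
  obtain ⟨vec, hP, hvec⟩ := exists_isRealization_D hm he
  have hsum := abs_sum_pathD_le_one hlr hl hr
  refine exists_isHeavyRootSource_of_abs_le_two hP hvec
    (G := potentialD fun k => (l k : ℤ) - r k) (fun i hi => ?_) (fun p q hpq => ?_)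
    (fun p hp => ?_)
  · have := hP.apply_coroot (b := b) ((2 : K) • φ) (potentialD fun k => (l k : ℤ) - r k)
      (forall_mem_support e fun k => by
        rw [hvec, simpleVectorD_dotProduct_potentialD, LinearMap.smul_apply,
          hd _ (RootPairing.Base.isPos_of_mem_support (e k).2), hde]
        push_cast
        rfl) i
    rw [LinearMap.smul_apply, hd i hi, smul_eq_mul] at this
    exact_mod_cast this
  · obtain ⟨c, rfl⟩ := Fin.exists_succ_eq.mpr (Fin.ne_zero_of_lt hpq)
    rw [potentialD_sub_potentialD _ (Fin.le_castSucc_iff.mpr hpq), abs_mul]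
    exact mul_le_of_le_one_right zero_le_two (hsum p _)
  · rw [potentialD_add_potentialD_last _ hp, abs_mul]
    exact mul_le_of_le_one_right zero_le_two (hsum p _)

variable {X : SLType} {n : ℕ} {e : Fin n ≃ b.support} (hn : X.minRank ≤ n)
  (he : ∀ k l, P.pairing (e k) (e l) = ((X.cartanMatrix n k l : ℤ) : K))
include hn he

theorem pairing_comm_of_cartanMatrix (i j : ι) : P.pairing i j = P.pairing j i := by
  cases X with
  | A =>
    obtain ⟨vec, hP, -⟩ := exists_isRealization_A he
    exact hP.pairing_comm i j
  | D =>
    have hn' : 4 ≤ n := hn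
    obtain ⟨m, rfl⟩ := Nat.exists_eq_add_of_le' (show 2 ≤ n by omega)
    obtain ⟨vec, hP, -⟩ := exists_isRealization_D (by omega) he
    exact hP.pairing_comm i j

theorem exists_isHeavyRootSource {l r : Fin n → ℕ} (hlr : ∀ k, l k + r k ≤ 1)
    (hl : Alternates l r X) (hr : Alternates r l X) {φ : N →ₗ[K] K} {d : ι → ℤ}
    (hd : ∀ i, b.IsPos i → φ (P.coroot i) = d i) (hde : ∀ k, d (e k) = (l k : ℤ) - r k) :
    ∃ β, IsHeavyRootSource b d β := by
  have hpos : ∀ k, b.IsPos (e k : ι) := fun k => RootPairing.Base.isPos_of_mem_support (e k).2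
  cases X with
  | A =>
    have hn' : 1 ≤ n := hn
    refine ⟨e ⟨0, hn'⟩, hpos _, fun γ hγ hdγ => absurd ?_ hdγ.not_ge⟩
    exact abs_le_one_of_alternates_A he hlr hl hr (fun k => by rw [hd _ (hpos k), hde]) (hd γ hγ)
  | D =>
    have hn' : 4 ≤ n := hn
    obtain ⟨m, rfl⟩ := Nat.exists_eq_add_of_le' (show 2 ≤ n by omega)
    exact exists_isHeavyRootSource_D (by omega) he hlr hl hr hd hde

end Alternation

section RootVectors

variable {K L : Type*} [Field K] [CharZero K] [LieRing L] [LieAlgebra K L] [FiniteDimensional K L]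
  [LieAlgebra.IsKilling K L] {H : LieSubalgebra K L} [H.IsCartanSubalgebra]
  [LieModule.IsTriangularizable K H L]

omit [CharZero K] in
theorem exists_mem_rootSpace_neg_ne_zero (α : H.root) : ∃ x ∈ rootSpace H (-α.1), x ≠ 0 := by
  simpa only [LieModule.Weight.coe_neg] using (-α.1).exists_ne_zero

theorem exists_eq_smul_of_mem_rootSpace_neg {α : H.root} {x y : L}
    (hx : x ∈ rootSpace H (-α.1)) (hy : y ∈ rootSpace H (-α.1)) (hy0 : y ≠ 0) :
    ∃ c : K, x = c • y := by
  have hα : (-α.1).IsNonZero := .neg (LieSubalgebra.isNonZero_coe_root α)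
  have hrank := finrank_rootSpace_eq_one _ hα
  rw [LieModule.Weight.coe_neg] at hrank
  obtain ⟨c, hc⟩ := (finrank_eq_one_iff_of_nonzero' (⟨y, hy⟩ : rootSpace H (-α.1))
    (by simpa [Subtype.ext_iff] using hy0)).mp hrank ⟨x, hx⟩
  exact ⟨c, (congrArg Subtype.val hc).symm⟩

theorem exists_isSl2Triple_coroot {α : H.root} {f : L} (hf : f ∈ rootSpace H (-α.1))
    (hf0 : f ≠ 0) : ∃ e ∈ rootSpace H α.1, IsSl2Triple ((rootSystem H).coroot α : L) e f := by
  have hα := LieSubalgebra.isNonZero_coe_root α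
  obtain ⟨h, e, f', ht, he, hf'⟩ := exists_isSl2Triple_of_weight_isNonZero hα
  obtain rfl : h = (rootSystem H).coroot α := by
    rw [rootSystem_coroot_apply, ht.h_eq_coroot hα he hf']
  obtain ⟨c, rfl⟩ := exists_eq_smul_of_mem_rootSpace_neg hf hf' ht.f_ne_zero
  have hc : c ≠ 0 := left_ne_zero_of_smul hf0
  refine ⟨c⁻¹ • e, Submodule.smul_mem _ _ he, ht.h_ne_zero, ?_, ?_, ?_⟩
  · rw [smul_lie, lie_smul, ht.lie_e_f, inv_smul_smul₀ hc]
  · rw [lie_smul, ht.lie_h_e_nsmul, smul_comm]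
  · rw [lie_smul, ht.lie_h_f_nsmul, smul_neg, smul_comm]

theorem lie_mem_rootSpace_neg_of_root_eq_add {α β γ : H.root}
    (hγ : (rootSystem H).root γ = (rootSystem H).root α + (rootSystem H).root β) {x y : L}
    (hx : x ∈ rootSpace H (-α.1)) (hy : y ∈ rootSpace H (-β.1)) :
    ⁅x, y⁆ ∈ rootSpace H (-γ.1) := by
  have hsum : (-⇑γ.1 : H → K) = -⇑α.1 + -⇑β.1 := by
    rw [← neg_add]
    exact congrArg Neg.neg (funext fun t => LinearMap.congr_fun hγ t)
  rw [hsum]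
  exact lie_mem_genWeightSpace_of_mem_genWeightSpace hx hy

theorem lie_ne_zero_of_pairing_eq_neg_one {α β : H.root}
    (h : (rootSystem H).pairing β α = -1) {x y : L}
    (hx : x ∈ rootSpace H (-α.1)) (hy : y ∈ rootSpace H (-β.1)) (hx0 : x ≠ 0) (hy0 : y ≠ 0) :
    ⁅x, y⁆ ≠ 0 := by
  intro hxy
  obtain ⟨e, -, ht⟩ := exists_isSl2Triple_coroot hx hx0
  have hprimitive : ht.symm.HasPrimitiveVectorWith y (-1 : K) :=
    { ne_zero := hy0
      lie_h := by
        have hlie := lie_eq_smul_of_mem_rootSpace hy ((rootSystem H).coroot α)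
        have hβα : β.1 ((rootSystem H).coroot α) = -1 := h
        rw [Pi.neg_apply, hβα, neg_neg, one_smul] at hlie
        rw [neg_lie, neg_one_smul, neg_inj]
        exact hlie
      lie_e := hxy }
  obtain ⟨n, hn⟩ := hprimitive.exists_nat
  have : ((n + 1 : ℕ) : K) = 0 := by rw [Nat.cast_succ, ← hn, neg_add_cancel]
  exact n.succ_ne_zero (Nat.cast_eq_zero.mp this)

variable (hsym : ∀ i j : H.root, (rootSystem H).pairing i j = (rootSystem H).pairing j i)
include hsym

theorem exists_eq_smul_lie_of_root_eq_add {α β γ : H.root}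
    (hγ : (rootSystem H).root γ = (rootSystem H).root α + (rootSystem H).root β) {x y z : L}
    (hx : x ∈ rootSpace H (-α.1)) (hx0 : x ≠ 0) (hy : y ∈ rootSpace H (-β.1)) (hy0 : y ≠ 0)
    (hz : z ∈ rootSpace H (-γ.1)) : ∃ c : K, z = c • ⁅x, y⁆ :=
  exists_eq_smul_of_mem_rootSpace_neg hz (lie_mem_rootSpace_neg_of_root_eq_add hγ hx hy)
    (lie_ne_zero_of_pairing_eq_neg_one
      (pairing_eq_neg_one_of_root_eq_add hsym (hγ.trans (add_comm _ _))) hx hy hx0 hy0)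

theorem lie_eq_zero_of_root_eq_add {α β γ : H.root}
    (hγ : (rootSystem H).root γ = (rootSystem H).root α + (rootSystem H).root β) {x y : L}
    (hx : x ∈ rootSpace H (-γ.1)) (hy : y ∈ rootSpace H (-β.1)) : ⁅x, y⁆ = 0 := by
  by_contra hxy
  have hlie := lie_mem_genWeightSpace_of_mem_genWeightSpace hx hy
  have hne : LieModule.genWeightSpace L (-⇑γ.1 + -⇑β.1 : H → K) ≠ ⊥ := by
    intro hbot
    rw [hbot] at hlie
    exact hxy ((LieSubmodule.mem_bot _).mp hlie)
  let χ : LieModule.Weight K H L := ⟨_, hne⟩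
  have hχ : ⇑(-χ) = ⇑γ.1 + ⇑β.1 := by
    rw [LieModule.Weight.coe_neg]
    change -(-⇑γ.1 + -⇑β.1) = _
    rw [neg_add, neg_neg, neg_neg]
  have hγβ : γ.1 ((rootSystem H).coroot β) = 1 := by
    have hpairing := pairing_left_add hγ β
    rw [pairing_eq_neg_one_of_root_eq_add hsym hγ, RootPairing.pairing_same] at hpairing
    exact hpairing.trans (by norm_num)
  have hββ : β.1 ((rootSystem H).coroot β) = 2 := RootPairing.pairing_same (rootSystem H) β
  have hnonzero : (-χ).IsNonZero := fun hzero => by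
    have hχβ := congrFun hχ ((rootSystem H).coroot β)
    rw [hzero, Pi.add_apply, hγβ, hββ, Pi.zero_apply] at hχβ
    norm_num at hχβ
  let δ : H.root := ⟨-χ, by simpa [LieSubalgebra.root] using hnonzero⟩
  exact root_ne_add_add hsym hγ δ (LinearMap.ext fun t => congrFun hχ t)

end RootVectors

section LocalWeyl

theorem isAddTorsionFree_of_module_algebra (k A M : Type*) [Field k] [CharZero k] [Ring A]
    [Algebra k A] [AddCommGroup M] [Module A M] : IsAddTorsionFree M :=
  letI := Module.compHom M (algebraMap k A)
  .of_isTorsionFree k M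

variable {L : Type*} [LieRing L] [LieAlgebra ℂ L] [FiniteDimensional ℂ L]
  [LieAlgebra.IsKilling ℂ L] {H : LieSubalgebra ℂ L} [H.IsCartanSubalgebra]
  {b : (rootSystem H).Base} {lam : Dual ℂ H}
  {M N : Type*} [AddCommGroup M] [Module (CurrentEnv L) M] [AddCommGroup N]
  [Module (CurrentEnv L) N]

omit [FiniteDimensional ℂ L] [LieAlgebra.IsKilling ℂ L] in
theorem cur_smul_smul_mem (P : Submodule (CurrentEnv L) M) {x : L} {r : ℕ} {v : M}
    (h : cur x r • v ∈ P) (c : ℂ) : cur (c • x) r • v ∈ P := by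
  rw [cur_smul, Algebra.smul_def, mul_smul]
  exact P.smul_mem _ h

omit [FiniteDimensional ℂ L] [LieAlgebra.IsKilling ℂ L] in
theorem cur_smul_pow_smul_eq_zero {x : L} {r n : ℕ} {v : M} (h : cur x r ^ n • v = 0) (c : ℂ) :
    cur (c • x) r ^ n • v = 0 := by
  rw [cur_smul, smul_pow, Algebra.smul_def, mul_smul, h, smul_zero]

theorem cur_coroot_mul_cur {α : H.root} {y : L} (hy : y ∈ rootSpace H (-α.1)) (r s : ℕ) :
    cur ((rootSystem H).coroot α : L) r * cur y s =
      cur y s * cur ((rootSystem H).coroot α : L) r - 2 • cur y (r + s) := by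
  have hαα : α.1 ((rootSystem H).coroot α) = 2 := RootPairing.pairing_same (rootSystem H) α
  have hlie : ⁅((rootSystem H).coroot α : L), y⁆ = (-2 : ℂ) • y := by
    rw [← hαα]
    exact lie_eq_smul_of_mem_rootSpace hy ((rootSystem H).coroot α)
  rw [cur_mul_cur, hlie, cur_smul, sub_eq_add_neg]
  module

/-- `w` satisfies the relations of the local Weyl module of highest weight `lam`. -/
def IsWeylVector (b : (rootSystem H).Base) (lam : Dual ℂ H) (w : M) : Prop :=
  ∀ u ∈ localWeylRel b lam, u • w = 0

namespace IsWeylVector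

variable {w : M} (hw : IsWeylVector b lam w)
include hw

theorem map (f : M →ₗ[CurrentEnv L] N) : IsWeylVector b lam (f w) :=
  fun u hu => by rw [← map_smul, hw u hu, map_zero]

theorem cur_smul_eq_zero_of_isPos {α : H.root} (hα : b.IsPos α) {x : L}
    (hx : x ∈ rootSpace H α.1) (r : ℕ) : cur x r • w = 0 :=
  hw _ (Or.inl (Or.inl ⟨α, hα, x, hx, r, rfl⟩))

theorem cur_zero_smul (h : H) : cur (h : L) 0 • w = algebraMap ℂ (CurrentEnv L) (lam h) • w := by
  have := hw _ (Or.inl (Or.inr ⟨h, 0, rfl⟩))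
  rwa [sub_smul, sub_eq_zero, if_pos rfl] at this

theorem cur_succ_smul (h : H) (r : ℕ) : cur (h : L) (r + 1) • w = 0 := by
  have := hw _ (Or.inl (Or.inr ⟨h, r + 1, rfl⟩))
  rwa [if_neg r.succ_ne_zero, map_zero, sub_zero] at this

theorem cur_smul_eq_zero_of_le {α : H.root} {y : L} (hy : y ∈ rootSpace H (-α.1)) {s k : ℕ}
    (hs : cur y s • w = 0) (hk : s ≤ k) : cur y k • w = 0 := by
  have := isAddTorsionFree_of_module_algebra ℂ (CurrentEnv L) M
  obtain rfl | ⟨r, rfl⟩ : s = k ∨ ∃ r, k = r + 1 + s :=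
    hk.eq_or_lt.imp_right fun hlt => ⟨k - s - 1, by omega⟩
  · exact hs
  have hcomm := congrArg (· • w) (cur_coroot_mul_cur hy (r + 1) s)
  simp only [sub_smul, mul_smul, smul_assoc, hs, hw.cur_succ_smul, smul_zero, zero_sub,
    eq_comm (a := (0 : M)), neg_eq_zero] at hcomm
  exact (smul_eq_zero_iff_right two_ne_zero).mp hcomm

variable (hsym : ∀ i j : H.root, (rootSystem H).pairing i j = (rootSystem H).pairing j i)
include hsym

theorem exists_cur_pow_smul_eq_zero {α : H.root} (hα : b.IsPos α) {y : L}
    (hy : y ∈ rootSpace H (-α.1)) : ∃ n : ℕ, cur y 0 ^ n • w = 0 := by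
  have := isAddTorsionFree_of_module_algebra ℂ (CurrentEnv L) M
  refine hα.induction_on_add
    (p := fun α => ∀ y ∈ rootSpace H (-α.1), ∃ n : ℕ, cur y 0 ^ n • w = 0)
    (fun i hi y hy => ⟨_, hw _ (Or.inr ⟨i, hi, y, hy, rfl⟩)⟩) ?_ y hy
  intro i j k hk ih hj z hz
  obtain ⟨yi, hyi, hyi0⟩ := exists_mem_rootSpace_neg_ne_zero i
  obtain ⟨yj, hyj, hyj0⟩ := exists_mem_rootSpace_neg_ne_zero j
  obtain ⟨c, rfl⟩ := exists_eq_smul_lie_of_root_eq_add hsym hk hyi hyi0 hyj hyj0 hz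
  have hlie := lie_mem_rootSpace_neg_of_root_eq_add hk hyi hyj
  obtain ⟨a, ha⟩ := ih yi hyi
  obtain ⟨n, hn⟩ := exists_pow_center_smul_eq_zero (cur_mul_cur yi yj 0 0)
    (commute_cur (lie_eq_zero_of_root_eq_add hsym (hk.trans (add_comm _ _)) hlie hyi) _ _)
    (commute_cur (lie_eq_zero_of_root_eq_add hsym hk hlie hyj) _ _) ha
    (hw _ (Or.inr ⟨j, hj, yj, hyj, rfl⟩))
  exact ⟨n, cur_smul_pow_smul_eq_zero hn c⟩

theorem cur_pow_ev_succ_smul_eq_zero (hlam : IsDominant b lam) {α : H.root} (hα : b.IsPos α)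
    {y : L} (hy : y ∈ rootSpace H (-α.1)) : cur y 0 ^ (ev lam α + 1) • w = 0 := by
  have := isAddTorsionFree_of_module_algebra ℂ (CurrentEnv L) M
  obtain rfl | hy0 := eq_or_ne y 0
  · rw [cur_zero, zero_pow (Nat.succ_ne_zero _), zero_smul]
  obtain ⟨x, hx, ht⟩ := exists_isSl2Triple_coroot hy hy0
  obtain ⟨n, hn⟩ := hw.exists_cur_pow_smul_eq_zero hsym hα hy
  refine pow_succ_smul_eq_zero_of_pow_smul_eq_zero (ht.lie_e_f ▸ cur_mul_cur x y 0 0)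
    (cur_coroot_mul_cur hy 0 0) (hw.cur_smul_eq_zero_of_isPos hα hx 0) ?_ hn
  rw [hw.cur_zero_smul, ← coe_ev hlam hα, map_natCast, Nat.cast_smul_eq_nsmul]

theorem cur_pow_smul_eq_zero (hlam : IsDominant b lam) {α : H.root} (hα : b.IsPos α) {y : L}
    (hy : y ∈ rootSpace H (-α.1)) {d r : ℕ} (hd : cur y (d + 1) • w = 0)
    (hr : ev lam α < r * (d + 1)) : cur y d ^ r • w = 0 := by
  have := isAddTorsionFree_of_module_algebra ℂ (CurrentEnv L) M
  obtain rfl | hy0 := eq_or_ne y 0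
  · rw [cur_zero, zero_pow (Nat.pos_of_mul_pos_right (pos_of_gt hr)).ne', zero_smul]
  obtain ⟨x, hx, ht⟩ := exists_isSl2Triple_coroot hy hy0
  refine pow_smul_eq_zero_of_garland (E := cur x 1) (Y := cur y)
    (K := fun j => cur ((rootSystem H).coroot α : L) (j + 1))
    (fun i j => commute_cur (lie_self y) i j) (fun j => ?_) (fun k j => ?_)
    (hw.cur_smul_eq_zero_of_isPos hα hx 1) (hw.cur_succ_smul _)
    (hw.cur_pow_ev_succ_smul_eq_zero hsym hlam hα hy)
    (fun k hk => hw.cur_smul_eq_zero_of_le hy hd hk) hr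
  · rw [cur_mul_cur, ht.lie_e_f, add_comm 1 j]
  · rw [cur_coroot_mul_cur hy, add_right_comm]

end IsWeylVector

end LocalWeyl

section Comparison

theorem natCeil_half (k : ℕ) : ⌈(k : ℚ) / 2⌉₊ = (k + 1) / 2 := by
  refine eq_of_forall_ge_iff fun n => ?_
  rw [Nat.ceil_le, div_le_iff₀ two_pos]
  norm_cast
  omega

variable {L : Type*} [LieRing L] [LieAlgebra ℂ L] [FiniteDimensional ℂ L]
  [LieAlgebra.IsKilling ℂ L] {H : LieSubalgebra ℂ L} [H.IsCartanSubalgebra]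
  {b : (rootSystem H).Base} {lam mu : Dual ℂ H}

theorem IsDominant.add (h₁ : IsDominant b lam) (h₂ : IsDominant b mu) :
    IsDominant b (lam + mu) := by
  intro i hi
  obtain ⟨k, hk⟩ := h₁ i hi
  obtain ⟨l, hl⟩ := h₂ i hi
  exact ⟨k + l, by rw [LinearMap.add_apply, hk, hl, Nat.cast_add]⟩

theorem ev_eq_add_of_root_eq_add
    (hsym : ∀ i j : H.root, (rootSystem H).pairing i j = (rootSystem H).pairing j i)
    (h : IsDominant b lam) {α β γ : H.root} (hα : b.IsPos α) (hβ : b.IsPos β)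
    (hγ : (rootSystem H).root γ = (rootSystem H).root α + (rootSystem H).root β) :
    ev lam γ = ev lam α + ev lam β := by
  have := coe_ev h (hα.add hβ hγ)
  rw [coroot_eq_add_of_root_eq_add hsym hγ, map_add, ← coe_ev h hα, ← coe_ev h hβ] at this
  exact_mod_cast this

theorem cur_mem_demazureRel {α : H.root} (hα : b.IsPos α) {x : L}
    (hx : x ∈ rootSpace H (-α.1)) : cur x ((ev lam α + 1) / 2) ∈ demazureRel b 2 lam :=
  Or.inr ⟨α, hα, x, hx, _, ev lam α + 2 - 2 * ((ev lam α + 1) / 2), by omega, by omega, by omega,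
    Or.inl rfl⟩

theorem isWeylVector_gen_vRel : IsWeylVector b (lam + mu) (gen (vRel b lam mu)) :=
  fun _ hu => smul_gen_eq_zero (Or.inl hu)

theorem isWeylVector_gen_demazureRel (l : ℕ) : IsWeylVector b lam (gen (demazureRel b l lam)) :=
  fun _ hu => smul_gen_eq_zero (Or.inl hu)

theorem kerVec_eq (y : H.root → L) (α : H.root) :
    kerVec b lam mu y α = cur (y α) ((ev (lam + mu) α + 1) / 2) • gen (vRel b lam mu) := by
  rw [kerVec, natCeil_half]

theorem cur_smul_gen_mem_of_kerVec_mem {y : H.root → L} {α : H.root}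
    (hy : y α ∈ rootSpace H (-α.1)) (hy0 : y α ≠ 0)
    {P : Submodule (CurrentEnv L) (V b lam mu)} (hP : kerVec b lam mu y α ∈ P) {x : L}
    (hx : x ∈ rootSpace H (-α.1)) :
    cur x ((ev (lam + mu) α + 1) / 2) • gen (vRel b lam mu) ∈ P := by
  obtain ⟨c, rfl⟩ := exists_eq_smul_of_mem_rootSpace_neg hx hy hy0
  exact cur_smul_smul_mem P (kerVec_eq y α ▸ hP) c

variable (h₁ : IsDominant b lam) (h₂ : IsDominant b mu)
include h₁ h₂

theorem ev_add {α : H.root} (hα : b.IsPos α) : ev (lam + mu) α = ev lam α + ev mu α := by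
  have h := coe_ev (h₁.add h₂) hα
  rw [LinearMap.add_apply, ← coe_ev h₁ hα, ← coe_ev h₂ hα] at h
  exact_mod_cast h

theorem sub_apply_coroot {α : H.root} (hα : b.IsPos α) :
    (lam - mu) ((rootSystem H).coroot α) = (((ev lam α : ℤ) - ev mu α : ℤ) : ℂ) := by
  rw [LinearMap.sub_apply, ← coe_ev h₁ hα, ← coe_ev h₂ hα]
  push_cast
  rfl

theorem smul_gen_demazureRel_eq_zero :
    ∀ u ∈ vRel b lam mu, u • gen (demazureRel b 2 (lam + mu)) = 0 := by
  rintro u (hu | ⟨α, hα, x, hx, rfl⟩)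
  · exact isWeylVector_gen_demazureRel 2 u hu
  · refine (isWeylVector_gen_demazureRel 2).cur_smul_eq_zero_of_le hx
      (smul_gen_eq_zero (cur_mem_demazureRel hα hx)) ?_
    rw [ev_add h₁ h₂ hα]
    omega

omit h₁ h₂ in
/-- The quotient map from `V(λ, μ)` to the level two Demazure module of weight `λ + μ`, sending
generator to generator. -/
def toDemazure (h₁ : IsDominant b lam) (h₂ : IsDominant b mu) :
    V b lam mu →ₗ[CurrentEnv L] Demazure b 2 (lam + mu) :=
  cyclicMap (smul_gen_demazureRel_eq_zero h₁ h₂)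

theorem kerVec_eq_zero {y : H.root → L} {α : H.root} (hα : b.IsPos α)
    (hy : y α ∈ rootSpace H (-α.1)) (hd : |(ev lam α : ℤ) - ev mu α| ≤ 1) :
    kerVec b lam mu y α = 0 := by
  have hmax : (ev (lam + mu) α + 1) / 2 = max (ev lam α) (ev mu α) := by
    rw [abs_le] at hd
    rw [ev_add h₁ h₂ hα]
    omega
  rw [kerVec_eq, hmax]
  exact smul_gen_eq_zero (Or.inr ⟨α, hα, _, hy, rfl⟩)

variable (hsym : ∀ i j : H.root, (rootSystem H).pairing i j = (rootSystem H).pairing j i)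
  {y : H.root → L} (hy : ∀ α : H.root, b.IsPos α → y α ∈ rootSpace H (-α.1) ∧ y α ≠ 0)
include hsym hy

theorem ker_toDemazure : LinearMap.ker (toDemazure h₁ h₂) =
    Submodule.span (CurrentEnv L) (kerVec b lam mu y '' {α | b.IsPos α}) := by
  set P := Submodule.span (CurrentEnv L) (kerVec b lam mu y '' {α | b.IsPos α})
  have hP {α : H.root} (hα : b.IsPos α) {x : L} (hx : x ∈ rootSpace H (-α.1)) :
      cur x ((ev (lam + mu) α + 1) / 2) • gen (vRel b lam mu) ∈ P :=
    cur_smul_gen_mem_of_kerVec_mem (hy α hα).1 (hy α hα).2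
      (Submodule.subset_span (Set.mem_image_of_mem _ hα)) hx
  rw [toDemazure, ker_cyclicMap]
  refine le_antisymm (Submodule.span_le.mpr ?_) (Submodule.span_mono ?_)
  · rintro _ ⟨u, hu | ⟨α, hα, x, hx, s, m, hm, hm', hs, rfl | ⟨hs0, rfl⟩⟩, rfl⟩
    · change u • gen (vRel b lam mu) ∈ P
      rw [isWeylVector_gen_vRel u hu]
      exact P.zero_mem
    · obtain rfl : s = (ev (lam + mu) α + 1) / 2 := by omega
      exact hP hα hx
    · -- The relation is a consequence of the linear one, by Garland's identity in `V(λ, μ) / P`.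
      obtain ⟨d, rfl⟩ := Nat.exists_eq_add_one.mpr hs0
      have hd : d + 1 = (ev (lam + mu) α + 1) / 2 := by omega
      have hd0 : cur x (d + 1) • P.mkQ (gen (vRel b lam mu)) = 0 := by
        rw [← map_smul, ← LinearMap.mem_ker, Submodule.ker_mkQ, hd]
        exact hP hα hx
      rw [SetLike.mem_coe, ← P.ker_mkQ, LinearMap.mem_ker, map_smul]
      refine (isWeylVector_gen_vRel.map P.mkQ).cur_pow_smul_eq_zero hsym (h₁.add h₂) hα hx hd0 ?_
      rw [Nat.add_sub_cancel]
      nlinarith [Nat.le_mul_of_pos_left d hm]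
  · rintro _ ⟨α, hα, rfl⟩
    exact ⟨_, cur_mem_demazureRel hα (hy α hα).1, (kerVec_eq y α).symm⟩

theorem kerVec_mem_of_addNullRoot {β γ : H.root}
    (h : AddNullRoot b (fun α => (ev lam α : ℤ) - ev mu α) β γ)
    {P : Submodule (CurrentEnv L) (V b lam mu)} (hβP : kerVec b lam mu y β ∈ P) :
    kerVec b lam mu y γ ∈ P := by
  obtain ⟨δ, hβ, hδ, hδ0, hγ⟩ := h
  obtain ⟨hyβ, hyβ0⟩ := hy β hβ
  obtain ⟨hyδ, hyδ0⟩ := hy δ hδ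
  have hγδβ := hγ.trans (add_comm _ _)
  obtain ⟨c, hc⟩ := exists_eq_smul_lie_of_root_eq_add hsym hγδβ hyδ hyδ0 hyβ hyβ0
    (hy γ (hβ.add hδ hγ)).1
  have hδ_eq : ev lam δ = ev mu δ := by exact_mod_cast sub_eq_zero.mp hδ0
  have hδ_zero : cur (y δ) (ev lam δ) • gen (vRel b lam mu) = 0 :=
    smul_gen_eq_zero (Or.inr ⟨δ, hδ, _, hyδ, by rw [← hδ_eq, max_self]⟩)
  have hs : (ev (lam + mu) γ + 1) / 2 = ev lam δ + (ev (lam + mu) β + 1) / 2 := by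
    rw [ev_eq_add_of_root_eq_add hsym (h₁.add h₂) hβ hδ hγ, ev_add h₁ h₂ hδ]
    omega
  have hlie := congrArg (· • gen (vRel b lam mu))
    (cur_mul_cur (y δ) (y β) (ev lam δ) ((ev (lam + mu) β + 1) / 2))
  simp only [add_smul, mul_smul, hδ_zero, smul_zero, zero_add] at hlie
  rw [kerVec_eq, hc, hs]
  refine cur_smul_smul_mem P ?_ c
  rw [← hlie, ← kerVec_eq]
  exact P.smul_mem _ hβP

theorem ker_toDemazure_eq_span_singleton {β : H.root}
    (hβ : IsHeavyRootSource b (fun α => (ev lam α : ℤ) - ev mu α) β) :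
    LinearMap.ker (toDemazure h₁ h₂) = Submodule.span (CurrentEnv L) {kerVec b lam mu y β} := by
  rw [ker_toDemazure h₁ h₂ hsym hy]
  refine le_antisymm (Submodule.span_le.mpr ?_)
    (Submodule.span_mono (Set.singleton_subset_iff.mpr (Set.mem_image_of_mem _ hβ.1)))
  rintro _ ⟨γ, hγ, rfl⟩
  rcases le_or_gt |(ev lam γ : ℤ) - ev mu γ| 1 with hd | hd
  · exact kerVec_eq_zero h₁ h₂ hγ (hy γ hγ).1 hd ▸ Submodule.zero_mem _
  · have hchain := (hβ.2 γ hγ hd).2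
    clear hγ hd
    induction hchain with
    | refl => exact Submodule.mem_span_singleton_self _
    | tail _ hstep ih => exact kerVec_mem_of_addNullRoot h₁ h₂ hsym hy hstep ih

end Comparison

section Interlacing

variable {L : Type*} [LieRing L] [LieAlgebra ℂ L] [FiniteDimensional ℂ L]
  [LieAlgebra.IsKilling ℂ L] {H : LieSubalgebra ℂ L} [H.IsCartanSubalgebra]
  {b : (rootSystem H).Base} {lam mu : Dual ℂ H} {X : SLType} {n : ℕ} {e : Fin n ≃ b.support}

theorem pairing_eq_cartanMatrix
    (he : ∀ i j, b.cartanMatrix (e i) (e j) = X.cartanMatrix n i j) (k l : Fin n) :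
    (rootSystem H).pairing (e k) (e l) = ((X.cartanMatrix n k l : ℤ) : ℂ) := by
  rw [← he, ← RootPairing.Base.algebraMap_cartanMatrixIn_apply (S := ℤ)]
  rfl

theorem IsInterlacing.exists_isHeavyRootSource (h : IsInterlacing X e lam mu)
    (h₁ : IsDominant b lam) (h₂ : IsDominant b mu) (hn : X.minRank ≤ n)
    (he : ∀ i j, b.cartanMatrix (e i) (e j) = X.cartanMatrix n i j) :
    ∃ β, IsHeavyRootSource b (fun α => (ev lam α : ℤ) - ev mu α) β := by
  obtain ⟨hle, hl, hr⟩ := h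
  refine CurrentAlg.exists_isHeavyRootSource hn (pairing_eq_cartanMatrix he) (fun k => ?_) hl hr
    (φ := lam - mu) (fun α => sub_apply_coroot h₁ h₂) fun _ => rfl
  rw [← ev_add h₁ h₂ (RootPairing.Base.isPos_of_mem_support (e k).2)]
  exact hle k

end Interlacing

end CurrentAlg

end

theorem mainTheorem4 {L : Type*} [LieRing L] [LieAlgebra ℂ L] [FiniteDimensional ℂ L]
    [LieAlgebra.IsSimple ℂ L] (H : LieSubalgebra ℂ L) [H.IsCartanSubalgebra]
    (b : (rootSystem H).Base)
    (X : CurrentAlg.SLType) (n : ℕ) (hn : X.minRank ≤ n) (e : Fin n ≃ b.support)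
    (he : ∀ i j, b.cartanMatrix (e i) (e j) = X.cartanMatrix n i j)
    (y : H.root → L)
    (hy : ∀ α : H.root, b.IsPos α → y α ∈ rootSpace H (-α.1) ∧ y α ≠ 0)
    (ν₁ ν₂ : Dual ℂ H) (h₁ : CurrentAlg.IsDominant b ν₁) (h₂ : CurrentAlg.IsDominant b ν₂)
    (h : CurrentAlg.IsInterlacing X e ν₁ ν₂) :
    (∃ f : CurrentAlg.V b ν₁ ν₂ ≃ₗ[CurrentAlg.CurrentEnv L] CurrentAlg.Demazure b 2 (ν₁ + ν₂),
      CurrentAlg.IsGraded f.toLinearMap ∧ CurrentAlg.IsGraded f.symm.toLinearMap ∧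
      f (CurrentAlg.gen _) = CurrentAlg.gen _) ∨
    ∃ β : H.root, b.IsPos β ∧ CurrentAlg.kerVec b ν₁ ν₂ y β ≠ 0 ∧
      (∀ γ : H.root, b.IsPos γ → CurrentAlg.kerVec b ν₁ ν₂ y γ ≠ 0 → γ ≠ β →
        b.height β < b.height γ) ∧
      ∃ ψ : CurrentAlg.V b ν₁ ν₂ →ₗ[CurrentAlg.CurrentEnv L] CurrentAlg.Demazure b 2 (ν₁ + ν₂),
        CurrentAlg.IsGraded ψ ∧ ψ (CurrentAlg.gen _) = CurrentAlg.gen _ ∧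
        Function.Injective
          (Submodule.span (CurrentAlg.CurrentEnv L) {CurrentAlg.kerVec b ν₁ ν₂ y β}).subtype ∧
        Function.Exact
          (Submodule.span (CurrentAlg.CurrentEnv L) {CurrentAlg.kerVec b ν₁ ν₂ y β}).subtype ψ ∧
        Function.Surjective ψ := by
  have hsym := CurrentAlg.pairing_comm_of_cartanMatrix hn (CurrentAlg.pairing_eq_cartanMatrix he)
  obtain ⟨β, hβ⟩ := h.exists_isHeavyRootSource h₁ h₂ hn he
  have hgen : CurrentAlg.toDemazure h₁ h₂ (CurrentAlg.gen _) = CurrentAlg.gen _ :=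
    CurrentAlg.cyclicMap_gen _
  have hsurj : Function.Surjective (CurrentAlg.toDemazure h₁ h₂) :=
    CurrentAlg.cyclicMap_surjective _
  have hker := CurrentAlg.ker_toDemazure_eq_span_singleton h₁ h₂ hsym hy hβ
  by_cases hβ0 : CurrentAlg.kerVec b ν₁ ν₂ y β = 0
  · rw [hβ0, Submodule.span_zero_singleton, LinearMap.ker_eq_bot] at hker
    let f := LinearEquiv.ofBijective (CurrentAlg.toDemazure h₁ h₂) ⟨hker, hsurj⟩
    exact Or.inl ⟨f, CurrentAlg.isGraded_of_map_gen hgen,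
      CurrentAlg.isGraded_of_map_gen (f.symm_apply_eq.mpr hgen.symm), hgen⟩
  · refine Or.inr ⟨β, hβ.1, hβ0, fun γ hγ hγ0 => (hβ.2 γ hγ ?_).1,
      CurrentAlg.toDemazure h₁ h₂, CurrentAlg.isGraded_of_map_gen hgen, hgen,
      Submodule.subtype_injective _, ?_, hsurj⟩
    · exact lt_of_not_ge fun hd => hγ0 (CurrentAlg.kerVec_eq_zero h₁ h₂ hγ (hy γ hγ).1 hd)
    · rw [LinearMap.exact_iff, hker, Submodule.range_subtype]
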